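/- A plane tree is a set $\mathbf t$ of finite words of positive integers that contains the empty word $\emptyset$ (the root), contains every prefix of each of its elements, and is such that for every $u\in\mathbf t$ there is $k_u(\mathbf t)\in\{0,1,2,\dots\}\cup\{\infty\}$ (the out-degree of $u$) with $ui\in\mathbf t$ if and only if $1\le i\le k_u(\mathbf t)$. Put $M(\mathbf t)=\sup\{k_u(\mathbf t):u\in\mathbf t\}$. The set of plane trees carries the topology of local convergence: $\mathbf t_n\to\mathbf t$ if and only if for every word $u$, for all sufficiently large $n$, $u\in\mathbf t_n\iff u\in\mathbf t$. Random trees are Borel measurable for this topology, and convergence in distribution is weak convergence of laws. Let $p=(p_0,p_1,\dots)$ be a probability distribution on the non-negative integers that is sub-critical, i.e. $\mu_p=\sum_n n\,p_n<1$, and unbounded, i.e. $\{n:p_n>0\}$ is unbounded. Let $\tau$ be a Galton–Watson tree with offspring distribution $p$: $k_\emptyset(\tau)$ has law $p$ and, for each $n$ with $p_n>0$, conditionally on $k_\emptyset(\tau)=n$ the $n$ sub-trees above the children of the root are independent and distributed as $\tau$. Let $\tau^*(p)$ be the condensation tree, defined as follows. Nodes are either normal or special, and the root is special. The numbers of children of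 all nodes are independent; a normal node has offspring distribution $p$, and a special node has $k$ children with probability $k\,p_k$ ($k=0,1,2,\dots$) and infinitely many children with probability $1-\mu_p$. All children of a normal node are normal. If a special node has finitely many children, one of them, chosen uniformly at random (independently of everything else), is special and the others are normal; if it has infinitely many children, all of them are normal. Then $\mathbb P(M(\tau)=n)>0$ for every $n$ with $p_n>0$, $\mathbb P(M(\tau)>n)>0$ for every $n\ge 0$, and, in the sense of convergence in distribution for the local topology, as $n\to\infty$, $$\operatorname{dist}(\tau\mid M(\tau)=n)\to\operatorname{dist}(\tau^*(p))\quad\text{along the infinite set }\{n:p_n>0\},$$ and $$\operatorname{dist}(\tau\mid M(\tau)>n)\to\operatorname{dist}(\tau^*(p)).$$ Moreover, almost surely $\tau^*(p)$ has exactly one node of infinite out-degree. -/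

import Mathlib

open MeasureTheory ProbabilityTheory Filter Topology
open scoped ENNReal

/-- A rooted ordered (plane) tree in Neveu's formalism: a set of finite words, containing the empty
word (the root), closed under taking ancestors, and such that the children of each vertex `u` are
`u0, u1, …, u(k-1)` for some `k ∈ ℕ ∪ {∞}`. Siblings are numbered from `0`. -/
@[ext]
structure PlaneTree where
  /-- the set of vertices -/
  carrier : Set (List ℕ)
  root_mem : [] ∈ carrier
  ancestor_mem : ∀ u w : List ℕ, u ++ w ∈ carrier → u ∈ carrier
  exists_degree : ∀ u ∈ carrier, ∃ k : ℕ∞, ∀ i : ℕ, u ++ [i] ∈ carrier ↔ (i : ℕ∞) < k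

namespace PlaneTree

instance : Membership (List ℕ) PlaneTree := ⟨fun t u => u ∈ t.carrier⟩

/-- The out-degree `k_u(t) ∈ ℕ ∪ {∞}`: the number of children of `u` in `t`. -/
noncomputable def outDegree (t : PlaneTree) (u : List ℕ) : ℕ∞ := {i : ℕ | u ++ [i] ∈ t}.encard

/-- The out-degree is the number `k` appearing in the definition of a tree. -/
theorem append_singleton_mem_iff (t : PlaneTree) {u : List ℕ} (hu : u ∈ t) (i : ℕ) :
    u ++ [i] ∈ t ↔ (i : ℕ∞) < t.outDegree u := by
  obtain ⟨k, hk⟩ := t.exists_degree u hu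
  have h : t.outDegree u = k := by
    have hset : {i : ℕ | u ++ [i] ∈ t} = {i : ℕ | (i : ℕ∞) < k} := Set.ext fun i => hk i
    rw [outDegree, hset]
    induction k using ENat.recTopCoe with
    | top => simp
    | coe n =>
      have : {i : ℕ | (i : ℕ∞) < (n : ℕ∞)} = ((Finset.range n : Finset ℕ) : Set ℕ) := by
        ext i; simp
      rw [this, Set.encard_coe_eq_coe_finsetCard, Finset.card_range]
  rw [h]
  exact hk i

/-- The maximal out-degree `M(t) = sup {k_u(t) : u ∈ t} ∈ ℕ ∪ {∞}`. -/
noncomputable def maxOutDegree (t : PlaneTree) : ℕ∞ := ⨆ u ∈ t.carrier, t.outDegree u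

open Classical in
/-- The sub-tree of `t` above the `i`-th child of the root, re-rooted at this child
(by convention the tree reduced to its root when the root has no `i`-th child). -/
def childSubtree (t : PlaneTree) (i : ℕ) : PlaneTree where
  carrier := if [i] ∈ t then {v | i :: v ∈ t} else {[]}
  root_mem := by 
    split_ifs with h
    · exact h
    · rfl
  ancestor_mem u w huw := by
    split_ifs at huw ⊢ with h
    · exact t.ancestor_mem (i :: u) w huw
    · simp_all
  exists_degree u hu := by
    split_ifs at hu ⊢ with h
    · exact t.exists_degree (i :: u) hu
    · exact ⟨0, fun j => by simp⟩

open Classical in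
/-- The topology of local convergence on the set of all trees (vertices of infinite degree
allowed): `tₙ → t` iff, for each word `u`, eventually `u ∈ tₙ ↔ u ∈ t`. -/
noncomputable instance : TopologicalSpace PlaneTree :=
  TopologicalSpace.induced (fun (t : PlaneTree) (u : List ℕ) => decide (u ∈ t)) inferInstance

noncomputable instance : MeasurableSpace PlaneTree := borel PlaneTree

instance : BorelSpace PlaneTree := ⟨rfl⟩

theorem tendsto_nhds_iff {ι : Type*} {l : Filter ι} {s : ι → PlaneTree} {t : PlaneTree} :
    Tendsto s l (𝓝 t) ↔ ∀ u : List ℕ, ∀ᶠ i in l, (u ∈ s i ↔ u ∈ t) := by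
  classical
  rw [nhds_induced, tendsto_comap_iff, tendsto_pi_nhds]
  refine forall_congr' fun u => ?_
  rw [nhds_discrete, tendsto_pure]
  simp [decide_eq_decide]

/-- The restriction of `t` to the words of length at most `h` with letters among the first `h`. -/
def ball (t : PlaneTree) (h : ℕ) : Set (List ℕ) :=
  {u | u ∈ t ∧ u.length ≤ h ∧ ∀ i ∈ u, i < h}

/-- The topology above is the one of the distance `2 ^ (- sup {h | ball t h = ball t' h})`. -/
theorem tendsto_nhds_iff_ball {ι : Type*} {l : Filter ι} {s : ι → PlaneTree} {t : PlaneTree} :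
    Tendsto s l (𝓝 t) ↔ ∀ h : ℕ, ∀ᶠ i in l, (s i).ball h = t.ball h := by
  rw [tendsto_nhds_iff]
  constructor
  · intro H h
    have hfin : {u : List ℕ | u.length ≤ h ∧ ∀ i ∈ u, i < h}.Finite := by
      refine ((List.finite_length_le (Fin h) h).image (List.map Fin.val)).subset ?_
      rintro u ⟨hu, hu'⟩
      refine ⟨u.pmap (fun i hi => ⟨i, hi⟩) hu', by simpa using hu, ?_⟩
      rw [List.map_pmap]
      simp
    filter_upwards [(hfin.eventually_all).2 fun u _ => H u] with i hi
    ext u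
    exact and_congr_left fun hu => hi u hu
  · intro H u
    filter_upwards [H (u.length + u.sum + 1)] with i hi
    have hu : u.length ≤ u.length + u.sum + 1 ∧ ∀ i ∈ u, i < u.length + u.sum + 1 :=
      ⟨by omega, fun j hj => by have := List.le_sum_of_mem hj; omega⟩
    have h := Set.ext_iff.1 hi u
    exact ⟨fun h' => (h.1 ⟨h', hu⟩).1, fun h' => (h.2 ⟨h', hu⟩).1⟩

/-- The tree in which each vertex `v` has `κ v` children. -/
def ofOffspring (κ : List ℕ → ℕ∞) : PlaneTree where
  carrier := {u | ∀ (v : List ℕ) (i : ℕ), v ++ [i] <+: u → (i : ℕ∞) < κ v}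
  root_mem v i h := by simp at h
  ancestor_mem u w h v i hv := h v i (hv.trans (List.prefix_append u w))
  exists_degree u hu := by
    refine ⟨κ u, fun i => ⟨fun h => h u i List.prefix_rfl, fun h v j hv => ?_⟩⟩
    rcases List.prefix_concat_iff.1 hv with h' | h'
    · obtain ⟨rfl, h''⟩ := List.append_inj' h' rfl
      obtain rfl : j = i := by simpa using h''
      exact h
    · exact hu v j h'

end PlaneTree

/-- A random tree `τ` is a Galton–Watson tree with offspring distribution `p` if the out-degree of
the root has law `p` and, conditionally on the root having `n` children, the `n` sub-trees above
these children are independent and distributed as `τ`. -/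
structure IsGaltonWatsonTree {Ω : Type*} [MeasurableSpace Ω] (p : PMF ℕ) (P : Measure Ω)
    (τ : Ω → PlaneTree) : Prop where
  measurable : Measurable τ
  root_degree : ∀ n : ℕ, P {ω | (τ ω).outDegree [] = n} = p n
  indep : ∀ n : ℕ, p n ≠ 0 →
    iIndepFun (fun (i : Fin n) ω => (τ ω).childSubtree i) P[|{ω | (τ ω).outDegree [] = n}]
  identDistrib : ∀ n : ℕ, p n ≠ 0 → ∀ i : Fin n,
    IdentDistrib (fun ω => (τ ω).childSubtree i) τ P[|{ω | (τ ω).outDegree [] = n}] P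

namespace PMF

/-- The expectation `μ_p = ∑ n p_n ∈ [0, ∞]`. -/
noncomputable def offspringMean (p : PMF ℕ) : ℝ≥0∞ := ∑' n : ℕ, (n : ℝ≥0∞) * p n

/-- The biased distribution on `ℕ ∪ {∞}`: mass `k p_k` at each `k ∈ ℕ` and `1 - μ_p` at `∞`. -/
noncomputable def biased (p : PMF ℕ) (hp : p.offspringMean ≤ 1) : PMF ℕ∞ :=
  ⟨fun k => if k = ⊤ then 1 - p.offspringMean else (k.toNat : ℝ≥0∞) * p k.toNat, by
    rw [ENNReal.summable.hasSum_iff, ENNReal.tsum_eq_add_tsum_ite (⊤ : ℕ∞),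
      ← (Nat.cast_injective (R := ℕ∞)).tsum_eq]
    · simpa [offspringMean] using tsub_add_cancel_of_le hp
    · intro k hk
      induction k using ENat.recTopCoe with
      | top => simp at hk
      | coe n => exact ⟨n, rfl⟩⟩

/-- Uniform choice of one of `k` children, for `1 ≤ k < ∞`. (No child is to be chosen when `k = ∞`,
and `k = 0` has probability zero; the value `0` is then a placeholder.) -/
noncomputable def uniformChild : ℕ∞ → PMF ℕ
  | ⊤ => PMF.pure 0
  | (0 : ℕ) => PMF.pure 0
  | (n + 1 : ℕ) => (PMF.uniformOfFintype (Fin (n + 1))).map Fin.val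

/-- Joint law of the number of children of a special node and of the position of its special
child. -/
noncomputable def specialLaw (p : PMF ℕ) (hp : p.offspringMean ≤ 1) : PMF (ℕ∞ × ℕ) :=
  (p.biased hp).bind fun k => (uniformChild k).map fun j => (k, j)

end PMF

namespace Condensation

/-- At each word `u`: the number of children of `u` if `u` is normal, and the number of
children together with the position of the special child if `u` is special. -/
abbrev Marks : Type := List ℕ → ℕ × (ℕ∞ × ℕ)

/-- The marks are independent; normal nodes have offspring law `p`, special nodes have the biased
offspring law with a uniformly chosen special child. -/
noncomputable def markLaw (p : PMF ℕ) (hp : p.offspringMean ≤ 1) : Measure Marks :=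
  Measure.infinitePi fun _ : List ℕ => p.toMeasure.prod (p.specialLaw hp).toMeasure

instance (p : PMF ℕ) (hp : p.offspringMean ≤ 1) : IsProbabilityMeasure (markLaw p hp) := by
  unfold markLaw; infer_instance

/-- The root is special; the child `vi` of `v` is special iff `v` is special, has finitely many
children, and `i` is its chosen child. All other nodes are normal. -/
def IsSpecial (m : Marks) (u : List ℕ) : Prop :=
  ∀ (v : List ℕ) (i : ℕ), v ++ [i] <+: u → (m v).2.1 ≠ ⊤ ∧ i = (m v).2.2

open Classical in
/-- The number of children of a node, according to its type. -/
noncomputable def offspring (m : Marks) (u : List ℕ) : ℕ∞ :=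
  if IsSpecial m u then (m u).2.1 else ((m u).1 : ℕ∞)

/-- The random tree `τ*(p)`, as a function of the marks; its law is the image of `markLaw p`. -/
noncomputable def tree (m : Marks) : PlaneTree := PlaneTree.ofOffspring (offspring m)

end Condensation

/-! For a set A of allowed degrees and a finite set W of words, let F_A(W) be the probability that τ
contains W and has all its degrees in A. Both conditioning events read "all degrees in B, not all in
A" with A ⊆ B: `Iio n ⊆ Iic n` for M = n, and `Iic n ⊆ univ` for M > n. The degree condition does
not involve W, so the conditional probability that τ contains W is (F_B(W) - F_A(W)) / r with r =
F_B(∅) - F_A(∅). The limit of this quotient suffices: by inclusion-exclusion, containment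
probabilities control the clopen cylinders, hence weak convergence (`tendsto_probabilityMeasure`).

Branching at the root writes F_A(W) as the sum over admissible k ∈ A of p_k times the product of the
F_A(tails W i), i < k. Subtracting leaves two terms (`containProb_sub_div`). For a root degree in A
one gets a difference of products; divided by r, it obeys a Leibniz rule in the limit, where one
child carries the quotient and the others their unconditioned probabilities. That child is the
special one, and its weight p_k for each of k positions is the size-biased degree with a uniform
choice (`specialLaw_coe`). Sub-criticality gives the dominating series ∑ k p_k.

A root degree in B \ A eventually exceeds every bound, and becomes the infinite degree in the limit.
Its weight needs no estimate on the tail of p: for W = ∅ the whole quotient is 1 and the first term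
tends to μ, which leaves 1 - μ (`tendsto_jumpProb_empty`). Hence the limits obey the recursion
`markLaw_treeEvent` of τ*(p), and induction on the length of the words identifies them
(`tendsto_containProb_sub_div`).

For the infinite node, the probability q that no special node has infinite degree satisfies q ≤ μ q,
so q = 0; the special nodes form a single line, which stops at its first infinite node. -/

/-! ### Finite sets of words and their first letters -/

/-- The words `v` such that `i :: v` belongs to `W`. -/
def tails (W : Set (List ℕ)) (i : ℕ) : Set (List ℕ) := {v | i :: v ∈ W}

/-- All the first letters of the words of `W` are smaller than `k`. -/
def Fits (W : Set (List ℕ)) (k : ℕ∞) : Prop := ∀ i v, i :: v ∈ W → (i : ℕ∞) < k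

theorem tails_empty (i : ℕ) : tails ∅ i = ∅ := rfl

theorem fits_empty (k : ℕ∞) : Fits ∅ k := fun _ _ h => h.elim

theorem Fits.tails_eq_empty {W : Set (List ℕ)} {k : ℕ} (h : Fits W k) {i : ℕ} (hi : k ≤ i) :
    tails W i = ∅ := by
  refine Set.eq_empty_of_forall_notMem fun v hv => ?_
  have := h i v hv
  norm_cast at this
  omega

theorem finite_tails {W : Set (List ℕ)} (hW : W.Finite) (i : ℕ) : (tails W i).Finite :=
  hW.preimage fun _ _ _ _ h => by simpa using h

/-- Fitting is monotone in k and holds past the largest first letter. The threshold j counts the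
children of the root that W can see. -/
theorem exists_forall_fits_iff {W : Set (List ℕ)} (hW : W.Finite) :
    ∃ j : ℕ, ∀ k : ℕ, Fits W k ↔ j ≤ k := by
  classical
  have hex : ∃ k : ℕ, Fits W k := by
    -- `headI` sends the empty word to 0, which is harmless for an upper bound.
    obtain ⟨b, hb⟩ := (hW.image fun w => w.headI).bddAbove
    refine ⟨b + 1, fun i v hv => ?_⟩
    have : i ≤ b := hb ⟨i :: v, hv, rfl⟩
    exact_mod_cast Nat.lt_succ_of_le this
  refine ⟨Nat.find hex, fun k => ⟨fun h => Nat.find_min' hex h, fun h i v hv => ?_⟩⟩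
  exact (Nat.find_spec hex i v hv).trans_le (by exact_mod_cast h)

/-! ### Cylinders, measurability and decomposition of trees at the root -/

namespace PlaneTree

theorem outDegree_eq_zero_of_notMem (t : PlaneTree) {u : List ℕ} (hu : u ∉ t) :
    t.outDegree u = 0 := by
  rw [outDegree, Set.encard_eq_zero]
  exact Set.eq_empty_of_forall_notMem fun i hi => hu (t.ancestor_mem u [i] hi)

theorem lt_outDegree_iff (t : PlaneTree) (u : List ℕ) (i : ℕ) :
    (i : ℕ∞) < t.outDegree u ↔ u ++ [i] ∈ t := by
  by_cases hu : u ∈ t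
  · exact (t.append_singleton_mem_iff hu i).symm
  · simp only [t.outDegree_eq_zero_of_notMem hu, not_lt_zero, false_iff]
    exact fun h => hu (t.ancestor_mem u [i] h)

/-- An element of `ℕ∞` is determined by the integers below it. A degree event thus becomes a
countable intersection of membership events, which makes it measurable. -/
theorem outDegree_eq_iff (t : PlaneTree) (u : List ℕ) (k : ℕ∞) :
    t.outDegree u = k ↔ ∀ i : ℕ, u ++ [i] ∈ t ↔ (i : ℕ∞) < k := by
  simp_rw [← t.lt_outDegree_iff]
  refine ⟨fun h => by simp [h], fun h => ENat.eq_of_forall_natCast_le_iff fun a => ?_⟩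
  cases a with
  | zero => simp
  | succ a => simpa [ENat.add_one_le_iff] using h a

open Classical in
theorem mem_childSubtree {t : PlaneTree} {i : ℕ} (h : [i] ∈ t) (v : List ℕ) :
    v ∈ t.childSubtree i ↔ i :: v ∈ t := by
  change v ∈ (if [i] ∈ t then {v | i :: v ∈ t} else {[]} : Set (List ℕ)) ↔ _
  rw [if_pos h]; rfl

theorem outDegree_childSubtree {t : PlaneTree} {i : ℕ} (h : [i] ∈ t) (v : List ℕ) :
    (t.childSubtree i).outDegree v = t.outDegree (i :: v) := by
  simp only [outDegree, mem_childSubtree h, List.cons_append]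

theorem nil_mem (t : PlaneTree) : [] ∈ t := t.root_mem

theorem singleton_mem_iff (t : PlaneTree) (i : ℕ) : [i] ∈ t ↔ (i : ℕ∞) < t.outDegree [] :=
  (t.lt_outDegree_iff [] i).symm

theorem singleton_mem_of_cons_mem {t : PlaneTree} {i : ℕ} {v : List ℕ} (h : i :: v ∈ t) :
    [i] ∈ t := t.ancestor_mem [i] v h

theorem isClopen_setOf_mem (u : List ℕ) : IsClopen {t : PlaneTree | u ∈ t} := by
  classical
  have h : Continuous fun t : PlaneTree => decide (u ∈ t) :=
    (continuous_apply u).comp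
      (continuous_induced_dom (f := fun (t : PlaneTree) (u : List ℕ) => decide (u ∈ t)))
  have := (isClopen_discrete {true}).preimage h
  convert! this using 1
  ext t; simp

theorem measurableSet_mem (u : List ℕ) : MeasurableSet {t : PlaneTree | u ∈ t} :=
  (isClopen_setOf_mem u).isOpen.measurableSet

instance : SecondCountableTopology PlaneTree :=
  TopologicalSpace.secondCountableTopology_induced _ _ _

/-- The trees containing `W` and avoiding `V`. -/
def wordCylinder (W V : Set (List ℕ)) : Set PlaneTree := {t | (∀ w ∈ W, w ∈ t) ∧ ∀ v ∈ V, v ∉ t}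

theorem isClopen_wordCylinder {W V : Set (List ℕ)} (hW : W.Finite) (hV : V.Finite) :
    IsClopen (wordCylinder W V) := by
  have : wordCylinder W V =
      (⋂ w ∈ W, {t : PlaneTree | w ∈ t}) ∩ ⋂ v ∈ V, {t : PlaneTree | v ∈ t}ᶜ := by
    ext t; simp [wordCylinder]
  rw [this]
  exact (hW.isClopen_biInter fun w _ => isClopen_setOf_mem w).inter
    (hV.isClopen_biInter fun v _ => (isClopen_setOf_mem v).compl)

/-- A basic open set of the product topology constrains finitely many words; these are sorted
according to whether they belong to t. -/
theorem exists_wordCylinder_subset {U : Set PlaneTree} (hU : IsOpen U) {t : PlaneTree} (ht : t ∈ U) :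
    ∃ W V : Set (List ℕ), W.Finite ∧ V.Finite ∧ t ∈ wordCylinder W V ∧ wordCylinder W V ⊆ U := by
  classical
  obtain ⟨O, hO, rfl⟩ := isOpen_induced_iff.1 hU
  obtain ⟨I, s, hs, hsub⟩ := isOpen_pi_iff.1 hO _ ht
  refine ⟨{u | u ∈ I ∧ u ∈ t}, {u | u ∈ I ∧ u ∉ t}, I.finite_toSet.subset fun u h => h.1,
    I.finite_toSet.subset fun u h => h.1, ⟨fun u h => h.2, fun u h => h.2⟩, fun t' ht' => ?_⟩
  refine hsub fun u hu => ?_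
  have : decide (u ∈ t') = decide (u ∈ t) := by
    by_cases h : u ∈ t
    · simp [h, ht'.1 u ⟨hu, h⟩]
    · simp [h, ht'.2 u ⟨hu, h⟩]
  change decide (u ∈ t') ∈ s u
  rw [this]
  exact (hs u hu).2

theorem borel_eq_generateFrom :
    (inferInstance : MeasurableSpace PlaneTree) =
      MeasurableSpace.generateFrom {S | ∃ W V : Set (List ℕ), W.Finite ∧ V.Finite ∧
        S = wordCylinder W V} := by
  have hb : TopologicalSpace.IsTopologicalBasis {S : Set PlaneTree | ∃ W V : Set (List ℕ),
      W.Finite ∧ V.Finite ∧ S = wordCylinder W V} := by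
    refine TopologicalSpace.isTopologicalBasis_of_isOpen_of_nhds ?_ fun t U ht hU => ?_
    · rintro _ ⟨W, V, hW, hV, rfl⟩
      exact (isClopen_wordCylinder hW hV).isOpen
    · obtain ⟨W, V, hW, hV, h, h'⟩ := exists_wordCylinder_subset hU ht
      exact ⟨_, ⟨W, V, hW, hV, rfl⟩, h, h'⟩
  exact hb.borel_eq_generateFrom

theorem measurable_of_mem {α : Type*} [MeasurableSpace α] {f : α → PlaneTree}
    (hf : ∀ u : List ℕ, MeasurableSet {x | u ∈ f x}) : Measurable f := by
  have : @Measurable α PlaneTree _ (MeasurableSpace.generateFrom {S | ∃ W V : Set (List ℕ),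
      W.Finite ∧ V.Finite ∧ S = wordCylinder W V}) f := by
    refine measurable_generateFrom ?_
    rintro _ ⟨W, V, hW, hV, rfl⟩
    have : f ⁻¹' wordCylinder W V = (⋂ w ∈ W, {x | w ∈ f x}) ∩ ⋂ v ∈ V, {x | v ∈ f x}ᶜ := by
      ext t; simp [wordCylinder]
    rw [this]
    exact (MeasurableSet.biInter hW.countable fun w _ => hf w).inter
      (MeasurableSet.biInter hV.countable fun w _ => (hf w).compl)
  rwa [← borel_eq_generateFrom] at this

theorem measurable_outDegree (u : List ℕ) : Measurable fun t : PlaneTree => t.outDegree u := by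
  refine measurable_to_countable' fun k => ?_
  have : (fun t : PlaneTree => t.outDegree u) ⁻¹' {k} =
      ⋂ i : ℕ, {t : PlaneTree | u ++ [i] ∈ t ↔ (i : ℕ∞) < k} := by
    ext t; simp [outDegree_eq_iff]
  rw [this]
  exact MeasurableSet.iInter fun i => (measurableSet_mem _).iff (.const _)

/-- The trees that contain `W` and all of whose out-degrees belong to `A`. -/
def containing (W : Set (List ℕ)) (A : Set ℕ∞) : Set PlaneTree :=
  {t | (∀ w ∈ W, w ∈ t) ∧ ∀ u ∈ t, t.outDegree u ∈ A}

theorem measurableSet_containing (W : Set (List ℕ)) (A : Set ℕ∞) :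
    MeasurableSet (containing W A) := by
  have : containing W A = (⋂ w ∈ W, {t : PlaneTree | w ∈ t}) ∩
      ⋂ u : List ℕ, ({t : PlaneTree | u ∈ t}ᶜ ∪ {t | t.outDegree u ∈ A}) := by
    ext t
    simp [containing, imp_iff_not_or]
  rw [this]
  exact (MeasurableSet.biInter W.to_countable fun w _ => measurableSet_mem w).inter
    (MeasurableSet.iInter fun u => (measurableSet_mem u).compl.union
      (measurable_outDegree u (.of_discrete)))

theorem containing_mono_right (W : Set (List ℕ)) {A B : Set ℕ∞} (h : A ⊆ B) :
    containing W A ⊆ containing W B := fun _ ht => ⟨ht.1, fun u hu => h (ht.2 u hu)⟩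

theorem containing_subset_empty (W : Set (List ℕ)) (A : Set ℕ∞) :
    containing W A ⊆ containing ∅ A := fun _ ht => ⟨fun _ h => h.elim, ht.2⟩

theorem containing_eq_of_subset_root {W : Set (List ℕ)} (h : ∀ w ∈ W, w = []) (A : Set ℕ∞) :
    containing W A = containing ∅ A := by
  refine (containing_subset_empty W A).antisymm fun t ht => ⟨fun w hw => ?_, ht.2⟩
  rw [h w hw]
  exact t.nil_mem

/-- Decomposition at the root. -/
theorem mem_containing_iff {t : PlaneTree} {k : ℕ} (hk : t.outDegree [] = k) (W : Set (List ℕ))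
    (A : Set ℕ∞) :
    t ∈ containing W A ↔
      ((k : ℕ∞) ∈ A ∧ Fits W k) ∧ ∀ i : Fin k, t.childSubtree i ∈ containing (tails W i) A := by
  have hmem : ∀ i : ℕ, [i] ∈ t ↔ i < k := fun i => by
    rw [singleton_mem_iff, hk, Nat.cast_lt]
  constructor
  · rintro ⟨hW, hA⟩
    refine ⟨⟨hk ▸ hA [] t.nil_mem, fun i v hv => ?_⟩, fun i => ?_⟩
    · exact_mod_cast (hmem i).1 (singleton_mem_of_cons_mem (hW _ hv))
    · have hi : [(i : ℕ)] ∈ t := (hmem i).2 i.2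
      refine ⟨fun w hw => (mem_childSubtree hi w).2 (hW _ hw), fun u hu => ?_⟩
      rw [outDegree_childSubtree hi]
      exact hA _ ((mem_childSubtree hi u).1 hu)
  · rintro ⟨⟨hkA, hfit⟩, hsub⟩
    refine ⟨fun w hw => ?_, fun u hu => ?_⟩
    · cases w with
      | nil => exact t.nil_mem
      | cons i v =>
        have hik : i < k := by exact_mod_cast hfit i v hw
        exact (mem_childSubtree ((hmem i).2 hik) v).1 ((hsub ⟨i, hik⟩).1 v hw)
    · cases u with
      | nil => rwa [hk]
      | cons i v =>
        have hi := singleton_mem_of_cons_mem hu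
        rw [← outDegree_childSubtree hi]
        exact (hsub ⟨i, (hmem i).1 hi⟩).2 v ((mem_childSubtree hi v).2 hu)

theorem maxOutDegree_le_iff (t : PlaneTree) (n : ℕ∞) :
    t.maxOutDegree ≤ n ↔ t ∈ containing ∅ (Set.Iic n) := by
  simp only [maxOutDegree, iSup_le_iff, containing, Set.mem_ofPred_eq, Set.mem_Iic]
  exact ⟨fun h => ⟨fun _ h => h.elim, h⟩, fun h => h.2⟩

theorem maxOutDegree_eq_iff (t : PlaneTree) (n : ℕ) :
    t.maxOutDegree = n ↔ t ∈ containing ∅ (Set.Iic (n : ℕ∞)) \ containing ∅ (Set.Iio (n : ℕ∞)) := by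
  rw [Set.mem_sdiff, ← maxOutDegree_le_iff, le_antisymm_iff, and_congr_right_iff]
  intro hle
  rw [iff_not_comm, not_le]
  constructor
  · intro h
    cases n with
    | zero => exact absurd (h.2 [] t.nil_mem) (by simp)
    | succ n =>
      -- Being below the integer n + 1 means being at most n, so the strict bound on each degree
      -- survives the supremum.
      have : t.maxOutDegree ≤ n := by
        rw [maxOutDegree_le_iff]
        refine ⟨fun _ h => h.elim, fun u hu => ?_⟩
        have := h.2 u hu
        simp only [Set.mem_Iio, Nat.cast_add, Nat.cast_one] at this
        exact Order.le_of_lt_add_one this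
      exact this.trans_lt (by exact_mod_cast Nat.lt_succ_self n)
  · exact fun h => ⟨fun _ h => h.elim, fun u hu =>
      (le_iSup₂ (f := fun u _ => t.outDegree u) u hu).trans_lt h⟩

theorem lt_maxOutDegree_iff (t : PlaneTree) (n : ℕ∞) :
    n < t.maxOutDegree ↔ t ∈ containing ∅ Set.univ \ containing ∅ (Set.Iic n) := by
  rw [Set.mem_sdiff, ← maxOutDegree_le_iff, not_le]
  simp [containing]

end PlaneTree

open PlaneTree

/-! ### The branching recursion for Galton–Watson trees -/

section GaltonWatson

variable {Ω : Type*} [MeasurableSpace Ω] {p : PMF ℕ} {P : Measure Ω} [IsProbabilityMeasure P]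
  {τ : Ω → PlaneTree}

theorem IsGaltonWatsonTree.measure_inter (hτ : IsGaltonWatsonTree p P τ) (W : Set (List ℕ))
    (A : Set ℕ∞) (k : ℕ) [Decidable ((k : ℕ∞) ∈ A ∧ Fits W k)] :
    P ({ω | (τ ω).outDegree [] = k} ∩ τ ⁻¹' containing W A) =
      if (k : ℕ∞) ∈ A ∧ Fits W k then
        p k * ∏ i ∈ Finset.range k, P (τ ⁻¹' containing (tails W i) A) else 0 := by
  have hmeas : MeasurableSet {ω | (τ ω).outDegree [] = k} :=
    ((measurable_outDegree []).comp hτ.measurable) (.singleton _)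
  -- When p_k = 0 nothing is known about the sub-trees, but both sides vanish.
  by_cases hk : p k = 0
  · have h0 : P {ω | (τ ω).outDegree [] = k} = 0 := by rw [hτ.root_degree, hk]
    rw [measure_mono_null Set.inter_subset_left h0]
    simp [hk]
  split_ifs with h
  · have hset : {ω | (τ ω).outDegree [] = k} ∩ τ ⁻¹' containing W A =
        {ω | (τ ω).outDegree [] = k} ∩
          ⋂ i : Fin k, (fun ω => (τ ω).childSubtree i) ⁻¹' containing (tails W i) A := by
      ext ω
      refine and_congr_right fun hω => ?_
      rw [Set.mem_preimage, mem_containing_iff hω]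
      simp [h]
    rw [hset, ← cond_mul_eq_inter hmeas, hτ.root_degree, mul_comm]
    congr 1
    rw [(hτ.indep k hk).meas_iInter fun i => ⟨_, measurableSet_containing _ _, rfl⟩,
      ← Fin.prod_univ_eq_prod_range (fun i => P (τ ⁻¹' containing (tails W i) A))]
    exact Finset.prod_congr rfl fun i _ =>
      (hτ.identDistrib k hk i).measure_mem_eq (measurableSet_containing _ _)
  · refine measure_mono_null (t := ∅) ?_ measure_empty
    rintro ω ⟨hω, hω'⟩
    exact h ((mem_containing_iff hω _ _).1 hω').1

open Classical in
/-- The branching recursion. -/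
theorem IsGaltonWatsonTree.measure_containing (hτ : IsGaltonWatsonTree p P τ) (W : Set (List ℕ))
    (A : Set ℕ∞) :
    P (τ ⁻¹' containing W A) = ∑' k : ℕ, if (k : ℕ∞) ∈ A ∧ Fits W k then
      p k * ∏ i ∈ Finset.range k, P (τ ⁻¹' containing (tails W i) A) else 0 := by
  have hmeas : ∀ k : ℕ, MeasurableSet {ω | (τ ω).outDegree [] = k} := fun k =>
    ((measurable_outDegree []).comp hτ.measurable) (.singleton _)
  have hdisj : Pairwise (Function.onFun Disjoint fun k : ℕ => {ω | (τ ω).outDegree [] = k}) := by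
    intro k l hkl
    refine Set.disjoint_left.2 fun ω (h : _ = _) (h' : _ = _) => hkl ?_
    exact_mod_cast h.symm.trans h'
  have hone : P (⋃ k : ℕ, {ω | (τ ω).outDegree [] = k}) = 1 := by
    rw [measure_iUnion hdisj hmeas]
    simp [hτ.root_degree, p.tsum_coe]
  -- The total mass of p is 1, so the root degree is almost surely finite and the event of an
  -- infinite root degree may be dropped.
  have hae : (τ ⁻¹' containing W A : Set Ω) =ᵐ[P]
      ⋃ k : ℕ, ({ω | (τ ω).outDegree [] = k} ∩ τ ⁻¹' containing W A : Set Ω) := by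
    rw [← Set.iUnion_inter]
    have := (prob_compl_eq_zero_iff (MeasurableSet.iUnion hmeas)).2 hone
    filter_upwards [mem_ae_iff.2 this] with ω hω
    exact propext ⟨fun h => ⟨hω, h⟩, fun h => h.2⟩
  rw [measure_congr hae, measure_iUnion
    (fun k l hkl => (hdisj hkl).mono Set.inter_subset_left Set.inter_subset_left)
    fun k => (hmeas k).inter (hτ.measurable (measurableSet_containing _ _))]
  exact tsum_congr fun k => hτ.measure_inter W A k

end GaltonWatson

/-! ### Discrete sums and the law of the mark of a special node -/

theorem ENNReal.tsum_enat (g : ℕ∞ → ℝ≥0∞) : ∑' k, g k = g ⊤ + ∑' n : ℕ, g n := by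
  rw [ENNReal.tsum_eq_add_tsum_ite (⊤ : ℕ∞), ← (Nat.cast_injective (R := ℕ∞)).tsum_eq]
  · simp
  · intro k hk
    induction k using ENat.recTopCoe with
    | top => simp at hk
    | coe n => exact ⟨n, rfl⟩

theorem MeasureTheory.measure_eq_tsum_fiber {α β : Type*} [MeasurableSpace α] [MeasurableSpace β]
    [MeasurableSingletonClass β] [Countable β] (μ : Measure α) {f : α → β} (hf : Measurable f)
    {S : Set α} (hS : MeasurableSet S) : μ S = ∑' b, μ (f ⁻¹' {b} ∩ S) := by
  rw [← measure_iUnion _ fun b => (hf (.singleton b)).inter hS, ← Set.iUnion_inter,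
    ← Set.preimage_iUnion, Set.iUnion_of_singleton, Set.preimage_univ, Set.univ_inter]
  · exact fun b c hbc => Set.disjoint_left.2 fun x hx hx' => hbc (hx.1.symm.trans hx'.1)

namespace PMF

theorem biased_top (p : PMF ℕ) (hp : p.offspringMean ≤ 1) :
    p.biased hp ⊤ = 1 - p.offspringMean := rfl

theorem biased_coe (p : PMF ℕ) (hp : p.offspringMean ≤ 1) (n : ℕ) :
    p.biased hp n = n * p n := rfl

theorem uniformChild_coe_apply (n l : ℕ) (hn : n ≠ 0) :
    uniformChild n l = if l < n then (n : ℝ≥0∞)⁻¹ else 0 := by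
  obtain ⟨n, rfl⟩ := Nat.exists_eq_succ_of_ne_zero hn
  change (PMF.uniformOfFintype (Fin (n + 1))).map Fin.val l = _
  rw [PMF.map_apply]
  split_ifs with h
  · rw [tsum_eq_single ⟨l, h⟩]
    · simp
    · intro b hb
      rw [if_neg]
      rintro rfl
      exact hb rfl
  · refine ENNReal.tsum_eq_zero.2 fun b => if_neg ?_
    rintro rfl
    exact h b.2

theorem specialLaw_apply (p : PMF ℕ) (hp : p.offspringMean ≤ 1) (k : ℕ∞) (l : ℕ) :
    p.specialLaw hp (k, l) = p.biased hp k * uniformChild k l := by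
  rw [specialLaw, PMF.bind_apply, tsum_eq_single k]
  · rw [PMF.map_apply, tsum_eq_single l]
    · simp
    · intro b hb
      simp [hb.symm]
  · intro k' hk'
    rw [PMF.map_apply]
    simp [hk'.symm]

/-- The factor n of the size bias cancels the 1/n of the uniform choice. The mass p_n for each
position is exactly what differentiating a product of n factors yields. -/
theorem specialLaw_coe (p : PMF ℕ) (hp : p.offspringMean ≤ 1) (n l : ℕ) :
    p.specialLaw hp (n, l) = if l < n then p n else 0 := by
  rw [specialLaw_apply, biased_coe]
  rcases eq_or_ne n 0 with rfl | hn
  · simp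
  · rw [uniformChild_coe_apply n l hn]
    split_ifs
    · rw [mul_comm (n : ℝ≥0∞), mul_assoc, ENNReal.mul_inv_cancel (by simpa using hn) (by simp),
        mul_one]
    · simp

theorem specialLaw_top (p : PMF ℕ) (hp : p.offspringMean ≤ 1) (l : ℕ) :
    p.specialLaw hp (⊤, l) = if l = 0 then 1 - p.offspringMean else 0 := by
  rw [specialLaw_apply, biased_top]
  change _ * PMF.pure 0 l = _
  simp [PMF.pure_apply]

end PMF

/-! ### Trees built from offspring numbers -/

/-- Membership in `ofOffspring` and `IsSpecial` are both conditions on every step of the path to a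
word; peeling off the first step gives their recursions at the root. -/
theorem forall_concat_prefix_cons_iff {Q : List ℕ → ℕ → Prop} (i : ℕ) (v : List ℕ) :
    (∀ (x : List ℕ) (j : ℕ), x ++ [j] <+: i :: v → Q x j) ↔
      Q [] i ∧ ∀ (x : List ℕ) (j : ℕ), x ++ [j] <+: v → Q (i :: x) j := by
  constructor
  · exact fun h => ⟨h [] i (by simp), fun x j hx => h (i :: x) j (by simpa using hx)⟩
  · rintro ⟨h0, h⟩ x j hx
    cases x with
    | nil =>
      obtain rfl : j = i := by simpa using hx
      exact h0
    | cons a x =>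
      rw [List.cons_append, List.cons_prefix_cons] at hx
      obtain ⟨rfl, hx⟩ := hx
      exact h x j hx

namespace PlaneTree

theorem mem_ofOffspring {κ : List ℕ → ℕ∞} {u : List ℕ} :
    u ∈ ofOffspring κ ↔ ∀ (v : List ℕ) (i : ℕ), v ++ [i] <+: u → (i : ℕ∞) < κ v := Iff.rfl

theorem cons_mem_ofOffspring {κ : List ℕ → ℕ∞} {i : ℕ} {v : List ℕ} :
    i :: v ∈ ofOffspring κ ↔ (i : ℕ∞) < κ [] ∧ v ∈ ofOffspring fun u => κ (i :: u) :=
  forall_concat_prefix_cons_iff i v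

theorem outDegree_ofOffspring {κ : List ℕ → ℕ∞} {u : List ℕ} (hu : u ∈ ofOffspring κ) :
    (ofOffspring κ).outDegree u = κ u := by
  rw [outDegree_eq_iff]
  refine fun i => ⟨fun h => h u i List.prefix_rfl, fun h v j hv => ?_⟩
  rcases List.prefix_concat_iff.1 hv with h' | h'
  · obtain ⟨rfl, h''⟩ := List.append_inj' h' rfl
    obtain rfl : j = i := by simpa using h''
    exact h
  · exact hu v j h'

theorem measurable_ofOffspring {α : Type*} [MeasurableSpace α] {κ : α → List ℕ → ℕ∞}
    (hκ : ∀ u, Measurable fun x => κ x u) : Measurable fun x => ofOffspring (κ x) := by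
  refine measurable_of_mem fun u => ?_
  simp only [mem_ofOffspring, Set.ofPred_forall]
  exact MeasurableSet.iInter fun v => MeasurableSet.iInter fun i => MeasurableSet.iInter fun _ =>
    hκ v (.of_discrete (s := {k | (i : ℕ∞) < k}))

theorem forall_mem_ofOffspring_iff {κ : List ℕ → ℕ∞} {W : Set (List ℕ)} :
    (∀ w ∈ W, w ∈ ofOffspring κ) ↔
      Fits W (κ []) ∧ ∀ i, ∀ v ∈ tails W i, v ∈ ofOffspring fun u => κ (i :: u) := by
  constructor
  · exact fun h => ⟨fun i v hv => (cons_mem_ofOffspring.1 (h _ hv)).1,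
      fun i v hv => (cons_mem_ofOffspring.1 (h _ hv)).2⟩
  · rintro ⟨h0, h⟩ w hw
    cases w with
    | nil => exact nil_mem _
    | cons i v => exact cons_mem_ofOffspring.2 ⟨h0 i v hw, h i v hw⟩

end PlaneTree

/-! ### Branching recursion and infinite node of the condensation tree -/

namespace Condensation

/-- The marks above the child `i` of the root. -/
def shift (m : Marks) (i : ℕ) : Marks := fun v => m (i :: v)

/-- Marks assembled from the mark of the root and the marks above each of its children. -/
def glue (x : (ℕ × (ℕ∞ × ℕ)) × (ℕ → Marks)) : Marks
  | [] => x.1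
  | i :: v => x.2 i v

/-- The law of the mark of a single node. -/
noncomputable def nodeLaw (p : PMF ℕ) (hp : p.offspringMean ≤ 1) : Measure (ℕ × (ℕ∞ × ℕ)) :=
  p.toMeasure.prod (p.specialLaw hp).toMeasure

instance (p : PMF ℕ) (hp : p.offspringMean ≤ 1) : IsProbabilityMeasure (nodeLaw p hp) := by
  unfold nodeLaw; infer_instance

theorem measurable_glue : Measurable glue := by
  refine measurable_pi_iff.2 fun u => ?_
  cases u with
  | nil => exact measurable_fst
  | cons i v => exact (measurable_pi_apply v).comp ((measurable_pi_apply i).comp measurable_snd)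

theorem measurable_shift (i : ℕ) : Measurable fun m : Marks => shift m i :=
  measurable_pi_iff.2 fun v => measurable_pi_apply (i :: v)

variable {p : PMF ℕ} {hp : p.offspringMean ≤ 1}

/-- The mark of the root and the marks above its children are independent. -/
theorem map_glue : ((nodeLaw p hp).prod (Measure.infinitePi fun _ : ℕ => markLaw p hp)).map glue =
    markLaw p hp := by
  classical
  refine Measure.eq_infinitePi _ fun s t ht => ?_
  set I : Finset ℕ := s.image List.headI with hI
  set V : Finset (List ℕ) := s.image List.tail with hV
  -- The non-empty words of s lie in the grid of words i :: v with i in I and v in V. Leaving the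
  -- other words of the grid unconstrained turns the box over s into a product over the root and
  -- this grid.
  let t' : List ℕ → Set (ℕ × (ℕ∞ × ℕ)) := fun u => if u ∈ s then t u else Set.univ
  have ht' : ∀ u, MeasurableSet (t' u) := fun u => by
    dsimp only [t']; split_ifs
    exacts [ht u, .univ]
  have hpre : glue ⁻¹' Set.pi s t =
      t' [] ×ˢ Set.pi (I : Set ℕ) fun i => Set.pi (V : Set (List ℕ)) fun v => t' (i :: v) := by
    ext x
    simp only [Set.mem_preimage, Set.mem_pi, Finset.mem_coe, Set.mem_prod]
    constructor
    · intro h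
      have h' : ∀ u, glue x u ∈ t' u := fun u => by
        dsimp only [t']; split_ifs with hu
        exacts [h u hu, trivial]
      exact ⟨h' [], fun i _ v _ => h' (i :: v)⟩
    · rintro ⟨h0, h⟩ u hu
      have h' : glue x u ∈ t' u := by
        cases u with
        | nil => exact h0
        | cons i v =>
          exact h i (Finset.mem_image.2 ⟨_, hu, rfl⟩) v (Finset.mem_image.2 ⟨_, hu, rfl⟩)
      simpa [t', hu] using h'
  rw [Measure.map_apply measurable_glue
    (.pi s.countable_toSet fun u _ => ht u), hpre, Measure.prod_prod,
    Measure.infinitePi_pi _ fun i _ => .pi V.countable_toSet fun v _ => ht' _]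
  simp only [markLaw]
  simp_rw [Measure.infinitePi_pi (fun _ : List ℕ => p.toMeasure.prod (p.specialLaw hp).toMeasure)
    fun v (_ : v ∈ V) => ht' _]
  change nodeLaw p hp (t' []) * ∏ i ∈ I, ∏ v ∈ V, nodeLaw p hp (t' (i :: v)) =
    ∏ u ∈ s, nodeLaw p hp (t u)
  rw [← Finset.prod_product']
  have hinj : Function.Injective fun x : ℕ × List ℕ => x.1 :: x.2 := by
    rintro ⟨i, v⟩ ⟨j, w⟩ h
    simpa using h
  rw [← Finset.prod_image (s := I ×ˢ V) (g := fun x : ℕ × List ℕ => x.1 :: x.2)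
    (f := fun u => nodeLaw p hp (t' u)) hinj.injOn,
    ← Finset.prod_insert (f := fun u => nodeLaw p hp (t' u)) (by simp)]
  have hsub : s ⊆ insert [] ((I ×ˢ V).image fun x : ℕ × List ℕ => x.1 :: x.2) := by
    intro u hu
    cases u with
    | nil => simp
    | cons i v =>
      refine Finset.mem_insert_of_mem (Finset.mem_image.2 ⟨(i, v), Finset.mem_product.2
        ⟨Finset.mem_image.2 ⟨_, hu, rfl⟩, Finset.mem_image.2 ⟨_, hu, rfl⟩⟩, rfl⟩)
  rw [← Finset.prod_subset hsub]
  · exact Finset.prod_congr rfl fun u hu => by simp [t', hu]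
  · intro u _ hu
    simp [t', hu]

theorem markLaw_branching {R : Set (ℕ × (ℕ∞ × ℕ))} (hR : MeasurableSet R) (s : Finset ℕ)
    {S : ℕ → Set Marks} (hS : ∀ i, MeasurableSet (S i)) :
    markLaw p hp {m | m [] ∈ R ∧ ∀ i ∈ s, shift m i ∈ S i} =
      nodeLaw p hp R * ∏ i ∈ s, markLaw p hp (S i) := by
  have hmeas : MeasurableSet {m : Marks | m [] ∈ R ∧ ∀ i ∈ s, shift m i ∈ S i} := by
    have : {m : Marks | m [] ∈ R ∧ ∀ i ∈ s, shift m i ∈ S i} =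
        (fun m : Marks => m []) ⁻¹' R ∩ ⋂ i ∈ s, (fun m => shift m i) ⁻¹' S i := by
      ext m; simp
    rw [this]
    exact ((measurable_pi_apply []) hR).inter
      (MeasurableSet.biInter s.countable_toSet fun i _ => measurable_shift i (hS i))
  conv_lhs => rw [← map_glue]
  rw [Measure.map_apply measurable_glue hmeas]
  have : glue ⁻¹' {m : Marks | m [] ∈ R ∧ ∀ i ∈ s, shift m i ∈ S i} =
      R ×ˢ Set.pi (s : Set ℕ) S := by
    ext x; rfl
  rw [this, Measure.prod_prod, Measure.infinitePi_pi _ fun i _ => hS i]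

theorem nodeLaw_fst (k : ℕ) : nodeLaw p hp {x | x.1 = k} = p k := by
  have : {x : ℕ × (ℕ∞ × ℕ) | x.1 = k} = {k} ×ˢ Set.univ := by ext; simp
  rw [this, nodeLaw, Measure.prod_prod, PMF.toMeasure_apply_singleton _ _ (.singleton _)]
  simp

theorem nodeLaw_snd (x : ℕ∞ × ℕ) : nodeLaw p hp {y | y.2 = x} = p.specialLaw hp x := by
  have : {y : ℕ × (ℕ∞ × ℕ) | y.2 = x} = Set.univ ×ˢ {x} := by ext; simp
  rw [this, nodeLaw, Measure.prod_prod, PMF.toMeasure_apply_singleton _ _ (.singleton _)]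
  simp

/-- The tree in which every node is normal. -/
noncomputable def normalTree (m : Marks) : PlaneTree := ofOffspring fun v => ((m v).1 : ℕ∞)

theorem measurable_normalTree : Measurable normalTree :=
  measurable_ofOffspring fun u =>
    (Measurable.of_discrete (f := fun x : ℕ × (ℕ∞ × ℕ) => (x.1 : ℕ∞))).comp (measurable_pi_apply u)

theorem isSpecial_nil (m : Marks) : IsSpecial m [] := fun v i h => by simp at h

theorem isSpecial_cons {m : Marks} {i : ℕ} {v : List ℕ} :
    IsSpecial m (i :: v) ↔ ((m []).2.1 ≠ ⊤ ∧ i = (m []).2.2) ∧ IsSpecial (shift m i) v :=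
  forall_concat_prefix_cons_iff (Q := fun v i => (m v).2.1 ≠ ⊤ ∧ i = (m v).2.2) i v

theorem measurableSet_isSpecial (u : List ℕ) : MeasurableSet {m | IsSpecial m u} := by
  simp only [IsSpecial, Set.ofPred_forall]
  exact MeasurableSet.iInter fun v => MeasurableSet.iInter fun i => MeasurableSet.iInter fun _ =>
    (MeasurableSet.of_discrete (s := {x : ℕ × (ℕ∞ × ℕ) | x.2.1 ≠ ⊤ ∧ i = x.2.2})).preimage
      (measurable_pi_apply v)

theorem measurable_tree : Measurable tree := by
  classical
  refine measurable_ofOffspring fun u => ?_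
  refine Measurable.ite (measurableSet_isSpecial u) ?_ ?_
  · exact (Measurable.of_discrete (f := fun x : ℕ × (ℕ∞ × ℕ) => x.2.1)).comp (measurable_pi_apply u)
  · exact (Measurable.of_discrete (f := fun x : ℕ × (ℕ∞ × ℕ) => (x.1 : ℕ∞))).comp
      (measurable_pi_apply u)

theorem offspring_nil (m : Marks) : offspring m [] = (m []).2.1 := if_pos (isSpecial_nil m)

theorem offspring_cons_of_special {m : Marks} {i : ℕ} (h : (m []).2.1 ≠ ⊤ ∧ i = (m []).2.2) :
    (fun v => offspring m (i :: v)) = offspring (shift m i) := by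
  ext1 v
  have : IsSpecial m (i :: v) ↔ IsSpecial (shift m i) v := by
    rw [isSpecial_cons]; exact and_iff_right h
  by_cases hv : IsSpecial (shift m i) v
  · rw [offspring, offspring, if_pos hv, if_pos (this.2 hv)]; rfl
  · rw [offspring, offspring, if_neg hv, if_neg (this.not.2 hv)]; rfl

theorem offspring_cons_of_normal {m : Marks} {i : ℕ} (h : ¬ ((m []).2.1 ≠ ⊤ ∧ i = (m []).2.2)) :
    (fun v => offspring m (i :: v)) = fun v => ((shift m i v).1 : ℕ∞) := by
  ext1 v
  simp only [offspring, isSpecial_cons, h, false_and, if_false]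
  rfl

/-- The marks for which `W` is contained in the condensation tree. -/
def treeEvent (W : Set (List ℕ)) : Set Marks := {m | ∀ w ∈ W, w ∈ tree m}

/-- The marks for which `W` is contained in the tree of normal nodes. -/
def normalEvent (W : Set (List ℕ)) : Set Marks := {m | ∀ w ∈ W, w ∈ normalTree m}

theorem measurableSet_treeEvent (W : Set (List ℕ)) : MeasurableSet (treeEvent W) := by
  have : treeEvent W = ⋂ w ∈ W, tree ⁻¹' {t | w ∈ t} := by ext; simp [treeEvent]
  rw [this]
  exact MeasurableSet.biInter W.to_countable fun w _ => measurable_tree (measurableSet_mem w)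

theorem measurableSet_normalEvent (W : Set (List ℕ)) : MeasurableSet (normalEvent W) := by
  have : normalEvent W = ⋂ w ∈ W, normalTree ⁻¹' {t | w ∈ t} := by ext; simp [normalEvent]
  rw [this]
  exact MeasurableSet.biInter W.to_countable fun w _ => measurable_normalTree (measurableSet_mem w)

theorem treeEvent_eq_univ {W : Set (List ℕ)} (h : ∀ w ∈ W, w = []) : treeEvent W = Set.univ :=
  Set.eq_univ_of_forall fun _ w hw => h w hw ▸ nil_mem _

theorem normalEvent_eq_univ {W : Set (List ℕ)} (h : ∀ w ∈ W, w = []) :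
    normalEvent W = Set.univ :=
  Set.eq_univ_of_forall fun _ w hw => h w hw ▸ nil_mem _

theorem forall_lt_iff_of_fits {W : Set (List ℕ)} {k : ℕ} (hW : Fits W k)
    {Q : ℕ → List ℕ → Prop} :
    (∀ i, ∀ v ∈ tails W i, Q i v) ↔ ∀ i ∈ Finset.range k, ∀ v ∈ tails W i, Q i v := by
  refine ⟨fun h i _ => h i, fun h i v hv => h i (Finset.mem_range.2 ?_) v hv⟩
  exact_mod_cast hW i v hv

theorem mem_normalEvent_iff {W : Set (List ℕ)} {m : Marks} {k : ℕ} (hk : (m []).1 = k) :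
    m ∈ normalEvent W ↔
      Fits W k ∧ ∀ i ∈ Finset.range k, shift m i ∈ normalEvent (tails W i) := by
  refine forall_mem_ofOffspring_iff.trans ?_
  rw [hk]
  exact and_congr_right fun h => forall_lt_iff_of_fits h

/-- The event that the sub-tree above a child of the root, special or normal, contains `W`. -/
def childEvent (W : Set (List ℕ)) (special : Prop) [Decidable special] : Set Marks :=
  if special then treeEvent W else normalEvent W

theorem measurableSet_childEvent (W : Set (List ℕ)) (special : Prop) [Decidable special] :
    MeasurableSet (childEvent W special) := by
  unfold childEvent
  split_ifs
  exacts [measurableSet_treeEvent W, measurableSet_normalEvent W]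

/-- The integer c is the number of children to inspect: k itself when k is finite, and a bound on
the first letters of W when k is infinite. -/
theorem mem_treeEvent_iff {W : Set (List ℕ)} {m : Marks} {k : ℕ∞} {l c : ℕ} (hm : (m []).2 = (k, l))
    (hc : Fits W k → Fits W c) :
    m ∈ treeEvent W ↔
      Fits W k ∧ ∀ i ∈ Finset.range c, shift m i ∈ childEvent (tails W i) (k ≠ ⊤ ∧ i = l) := by
  refine forall_mem_ofOffspring_iff.trans ?_
  rw [offspring_nil, hm]
  refine and_congr_right fun h => (forall_lt_iff_of_fits (hc h)).trans ?_
  refine forall₂_congr fun i _ => ?_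
  by_cases hi : k ≠ ⊤ ∧ i = l
  · rw [offspring_cons_of_special (by rwa [hm]), childEvent, if_pos hi]; rfl
  · rw [offspring_cons_of_normal (by rwa [hm]), childEvent, if_neg hi]; rfl

open Classical in
theorem markLaw_normalEvent (W : Set (List ℕ)) :
    markLaw p hp (normalEvent W) = ∑' k : ℕ, if Fits W k then
      p k * ∏ i ∈ Finset.range k, markLaw p hp (normalEvent (tails W i)) else 0 := by
  rw [measure_eq_tsum_fiber _ (f := fun m : Marks => (m []).1)
    ((measurable_fst).comp (measurable_pi_apply [])) (measurableSet_normalEvent W)]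
  refine tsum_congr fun k => ?_
  split_ifs with h
  · rw [← nodeLaw_fst (hp := hp), ← markLaw_branching (.of_discrete) _
      fun i => measurableSet_normalEvent _]
    congr 1
    ext m
    refine and_congr_right fun hm => ?_
    rw [mem_normalEvent_iff hm]
    simp [h]
  · refine measure_mono_null (t := ∅) ?_ measure_empty
    rintro m ⟨hm, hm'⟩
    exact h ((mem_normalEvent_iff hm).1 hm').1

open Classical in
theorem markLaw_treeEvent_fiber {W : Set (List ℕ)} {k : ℕ∞} {l c : ℕ} (hc : Fits W k → Fits W c) :
    markLaw p hp ((fun m : Marks => (m []).2) ⁻¹' {(k, l)} ∩ treeEvent W) =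
      if Fits W k then p.specialLaw hp (k, l) * ∏ i ∈ Finset.range c,
        markLaw p hp (childEvent (tails W i) (k ≠ ⊤ ∧ i = l)) else 0 := by
  split_ifs with h
  · rw [← nodeLaw_snd, ← markLaw_branching (.of_discrete) _
      fun i => measurableSet_childEvent _ _]
    congr 1
    ext m
    refine and_congr_right fun hm => ?_
    rw [mem_treeEvent_iff hm hc]
    simp [h]
  · refine measure_mono_null (t := ∅) ?_ measure_empty
    rintro m ⟨hm, hm'⟩
    exact h ((mem_treeEvent_iff hm hc).1 hm').1

open Classical in
-- An infinite root has only normal children, of which W constrains at most the first j. A finite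
-- root has degree k and special child l with mass p_k, and the remaining children are normal.
theorem markLaw_treeEvent {W : Set (List ℕ)} {j : ℕ} (hj : Fits W j) :
    markLaw p hp (treeEvent W) =
      (1 - p.offspringMean) * ∏ i ∈ Finset.range j, markLaw p hp (normalEvent (tails W i)) +
      ∑' k : ℕ, if Fits W k then p k * ∑ l ∈ Finset.range k, markLaw p hp (treeEvent (tails W l)) *
        ∏ i ∈ (Finset.range k).erase l, markLaw p hp (normalEvent (tails W i)) else 0 := by
  rw [measure_eq_tsum_fiber _ (f := fun m : Marks => (m []).2)
    ((measurable_snd).comp (measurable_pi_apply [])) (measurableSet_treeEvent W),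
    ENNReal.summable.tsum_prod' fun _ => ENNReal.summable, ENNReal.tsum_enat]
  congr 1
  · rw [tsum_eq_single 0]
    · rw [markLaw_treeEvent_fiber fun _ => hj,
        if_pos (show Fits W ⊤ from fun i v _ => ENat.natCast_lt_top i),
        PMF.specialLaw_top]
      simp [childEvent]
    · intro l hl
      rw [markLaw_treeEvent_fiber fun _ => hj, PMF.specialLaw_top]
      simp [hl]
  · refine tsum_congr fun k => ?_
    split_ifs with h
    · rw [tsum_eq_sum (s := Finset.range k), Finset.mul_sum]
      · refine Finset.sum_congr rfl fun l hl => ?_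
        rw [markLaw_treeEvent_fiber id, if_pos h, PMF.specialLaw_coe,
          if_pos (Finset.mem_range.1 hl), ← Finset.mul_prod_erase _ _ hl]
        congr 2
        · simp [childEvent]
        · refine Finset.prod_congr rfl fun i hi => ?_
          simp [childEvent, (Finset.mem_erase.1 hi).1]
      · intro l hl
        rw [markLaw_treeEvent_fiber id, if_pos h, PMF.specialLaw_coe, if_neg (by simpa using hl),
          zero_mul]
    · refine ENNReal.tsum_eq_zero.2 fun l => ?_
      rw [markLaw_treeEvent_fiber id, if_neg h]

theorem IsSpecial.of_prefix {m : Marks} {u v : List ℕ} (h : IsSpecial m u) (hv : v <+: u) :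
    IsSpecial m v := fun w i hw => h w i (hw.trans hv)

/-- Special nodes follow a single path, each step going to the chosen child, and this path cannot
continue beyond an infinite node. -/
theorem IsSpecial.prefix_of_eq_top {m : Marks} {u v : List ℕ} (hu : IsSpecial m u)
    (hv : IsSpecial m v) (htop : (m u).2.1 = ⊤) : v <+: u := by
  induction v using List.reverseRecOn with
  | nil => exact List.nil_prefix
  | append_singleton x i ih =>
    obtain ⟨y, rfl⟩ := ih (hv.of_prefix (List.prefix_append _ _))
    obtain ⟨hne, hi⟩ := hv x i List.prefix_rfl
    cases y with
    | nil => simp [hne] at htop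
    | cons j y =>
      have h : x ++ [j] <+: x ++ j :: y := by simp
      rw [hi, ← (hu x j h).2]
      exact h

/-- Almost surely, some special node has infinitely many children. -/
theorem ae_exists_special_top (hlt : p.offspringMean < 1) :
    ∀ᵐ m ∂(markLaw p hp), ∃ u, IsSpecial m u ∧ (m u).2.1 = ⊤ := by
  classical
  set N : Set Marks := {m | ∀ u, IsSpecial m u → (m u).2.1 ≠ ⊤} with hN
  have hmeas : MeasurableSet N := by
    have : N = ⋂ u, ({m | IsSpecial m u}ᶜ ∪ (fun m : Marks => m u) ⁻¹' {x | x.2.1 ≠ ⊤}) := by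
      ext m; simp [hN, imp_iff_not_or]
    rw [this]
    exact MeasurableSet.iInter fun u => (measurableSet_isSpecial u).compl.union
      (measurable_pi_apply u (.of_discrete))
  -- On N the root degree is finite and N occurs again above the chosen child, independently of the
  -- mark of the root.
  have hfib : ∀ (k : ℕ∞) (l : ℕ), markLaw p hp ((fun m : Marks => (m []).2) ⁻¹' {(k, l)} ∩ N) ≤
      if k = ⊤ then 0 else p.specialLaw hp (k, l) * markLaw p hp N := by
    intro k l
    split_ifs with hk
    · refine (measure_mono_null (t := ∅) ?_ measure_empty).le
      rintro m ⟨hm, hm'⟩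
      have hm2 : (m []).2 = (k, l) := hm
      exact hm' [] (isSpecial_nil m) (by rw [hm2, hk])
    · have := markLaw_branching (p := p) (hp := hp)
        (.of_discrete (s := {y : ℕ × (ℕ∞ × ℕ) | y.2 = (k, l)})) {l} (S := fun _ => N)
        fun _ => hmeas
      rw [nodeLaw_snd, Finset.prod_singleton] at this
      rw [← this]
      refine measure_mono ?_
      rintro m ⟨hm, hm'⟩
      have hm2 : (m []).2 = (k, l) := hm
      refine ⟨hm, fun i hi u hu => ?_⟩
      rw [Finset.mem_singleton] at hi
      subst hi
      exact hm' (i :: u) (isSpecial_cons.2 ⟨by simp [hm2, hk], hu⟩)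
  -- For each n, the n possible positions have mass p_n, so finite root degrees contribute ∑ n p_n
  -- in all.
  have hle : markLaw p hp N ≤ p.offspringMean * markLaw p hp N := by
    conv_lhs => rw [measure_eq_tsum_fiber _ (f := fun m : Marks => (m []).2)
      ((measurable_snd).comp (measurable_pi_apply [])) hmeas]
    refine (ENNReal.tsum_le_tsum fun x : ℕ∞ × ℕ => hfib x.1 x.2).trans ?_
    rw [ENNReal.summable.tsum_prod' fun _ => ENNReal.summable, ENNReal.tsum_enat]
    simp only [if_true, tsum_zero, zero_add, ENat.natCast_ne_top, if_false]
    simp_rw [ENNReal.tsum_mul_right]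
    refine mul_le_mul_left (ENNReal.tsum_le_tsum fun n => ?_) _
    rw [tsum_eq_sum (s := Finset.range n)]
    · refine (Finset.sum_le_card_nsmul _ _ (p n) fun l _ => ?_).trans (by simp)
      rw [PMF.specialLaw_coe]
      split_ifs <;> simp
    · intro l hl
      rw [PMF.specialLaw_coe, if_neg (by simpa using hl)]
  have hzero : markLaw p hp N = 0 := by
    by_contra h
    have := ENNReal.mul_lt_mul_left h (measure_ne_top _ _) hlt
    rw [one_mul] at this
    exact absurd this hle.not_gt
  rw [ae_iff]
  convert! hzero using 2
  ext m
  simp [hN]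

/-- Almost surely, the chosen child of a special node of finite out-degree exists. -/
theorem ae_chosen_lt (hp' : p.offspringMean ≤ 1) :
    ∀ᵐ m ∂(markLaw p hp'), ∀ u, (m u).2.1 ≠ ⊤ → ((m u).2.2 : ℕ∞) < (m u).2.1 := by
  have key : ∀ᵐ m ∂(markLaw p hp'), ∀ (u : List ℕ) (n l : ℕ), n ≤ l → (m u).2 ≠ ((n : ℕ∞), l) := by
    refine ae_all_iff.2 fun u => ae_all_iff.2 fun n => ae_all_iff.2 fun l => ?_
    by_cases hnl : n ≤ l
    · simp only [hnl, true_imp_iff]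
      have h := (measurePreserving_eval_infinitePi (fun _ : List ℕ => nodeLaw p hp') u).measure_preimage
        (MeasurableSet.of_discrete (s := {y | y.2 = ((n : ℕ∞), l)})).nullMeasurableSet
      rw [nodeLaw_snd, PMF.specialLaw_coe, if_neg (by omega)] at h
      rw [ae_iff]
      convert! h using 2
      ext m; simp
    · simp [hnl]
  filter_upwards [key] with m hm u hu
  by_contra hlt
  obtain ⟨n, hn⟩ := ENat.ne_top_iff_exists.1 hu
  refine hm u n (m u).2.2 ?_ (Prod.ext hn.symm rfl)
  rw [← hn, not_lt] at hlt
  exact_mod_cast hlt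

/-- A special node of infinite degree belongs to the tree because every chosen child on the way
exists. Normal nodes have finite degree, and two infinite special nodes are prefixes of each other.
-/
theorem ae_existsUnique_outDegree_eq_top (hlt : p.offspringMean < 1) :
    ∀ᵐ m ∂(markLaw p hlt.le), ∃! u : List ℕ, u ∈ tree m ∧ (tree m).outDegree u = ⊤ := by
  filter_upwards [ae_exists_special_top (hp := hlt.le) hlt, ae_chosen_lt hlt.le] with m hm hm'
  obtain ⟨u, hu, htop⟩ := hm
  have hmem : u ∈ tree m := fun v i hv => by
    rw [offspring, if_pos (hu.of_prefix ((List.prefix_append _ _).trans hv)), (hu v i hv).2]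
    exact hm' v (hu v i hv).1
  refine ⟨u, ⟨hmem, ?_⟩, ?_⟩
  · rw [tree, outDegree_ofOffspring hmem, offspring, if_pos hu, htop]
  · rintro v ⟨hv, hdeg⟩
    rw [tree, outDegree_ofOffspring hv, offspring] at hdeg
    split_ifs at hdeg with hs
    · exact (hu.prefix_of_eq_top hs htop).eq_of_length_le
        (hs.prefix_of_eq_top hu hdeg).length_le
    · exact absurd hdeg (ENat.natCast_ne_top _)

end Condensation

/-! ### Differentiating products, and dominated convergence -/

section Analysis

variable {ι : Type*} {l : Filter ι} {α β : ι → ℕ → ℝ} {r : ι → ℝ} {φ ψ : ℕ → ℝ}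

/-- A discrete Leibniz rule, by induction from bb' - aa' = (b - a)b' + a(b' - a'). -/
theorem tendsto_prod_sub_prod_div (hα : ∀ x, Tendsto (fun i => α i x) l (𝓝 (φ x)))
    (hβ : ∀ x, Tendsto (fun i => β i x) l (𝓝 (φ x)))
    (hd : ∀ x, Tendsto (fun i => (β i x - α i x) / r i) l (𝓝 (ψ x))) (s : Finset ℕ) :
    Tendsto (fun i => (∏ x ∈ s, β i x - ∏ x ∈ s, α i x) / r i) l
      (𝓝 (∑ x ∈ s, ψ x * ∏ y ∈ s.erase x, φ y)) := by
  induction s using Finset.induction_on with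
  | empty => simpa using tendsto_const_nhds
  | insert a s ha ih =>
    have hlim : ∑ x ∈ insert a s, ψ x * ∏ y ∈ (insert a s).erase x, φ y =
        ψ a * ∏ y ∈ s, φ y + φ a * ∑ x ∈ s, ψ x * ∏ y ∈ s.erase x, φ y := by
      rw [Finset.sum_insert ha, Finset.erase_insert ha, Finset.mul_sum]
      congr 1
      refine Finset.sum_congr rfl fun x hx => ?_
      have hne : a ≠ x := fun h => ha (h ▸ hx)
      rw [Finset.erase_insert_of_ne hne,
        Finset.prod_insert fun h => ha (Finset.mem_of_mem_erase h)]
      ring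
    rw [hlim]
    refine (((hd a).mul (tendsto_finsetProd s fun x _ => hβ x)).add ((hα a).mul ih)).congr
      fun i => ?_
    rw [Finset.prod_insert ha, Finset.prod_insert ha]
    ring

/-- Changing the factors one at a time costs at most c each, since the others are at most 1. This
linear bound is what makes a finite mean enough for domination. -/
theorem prod_sub_prod_mem_Icc {a b : ℕ → ℝ} {c : ℝ} (ha : ∀ x, 0 ≤ a x) (hab : ∀ x, a x ≤ b x)
    (hb : ∀ x, b x ≤ 1) (hc : ∀ x, b x - a x ≤ c) (k : ℕ) :
    ∏ x ∈ Finset.range k, b x - ∏ x ∈ Finset.range k, a x ∈ Set.Icc 0 (k * c) := by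
  have hb0 : ∀ x, 0 ≤ b x := fun x => (ha x).trans (hab x)
  refine ⟨sub_nonneg.2 (Finset.prod_le_prod (fun x _ => ha x) fun x _ => hab x), ?_⟩
  induction k with
  | zero => simp
  | succ k ih =>
    rw [Finset.prod_range_succ, Finset.prod_range_succ]
    have h1 : ∏ x ∈ Finset.range k, b x ≤ 1 := Finset.prod_le_one (fun x _ => hb0 x) fun x _ => hb x
    have h0 : 0 ≤ ∏ x ∈ Finset.range k, b x := Finset.prod_nonneg fun x _ => hb0 x
    have h2 : 0 ≤ ∏ x ∈ Finset.range k, b x - ∏ x ∈ Finset.range k, a x :=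
      sub_nonneg.2 (Finset.prod_le_prod (fun x _ => ha x) fun x _ => hab x)
    have h3 := sub_nonneg.2 (hab k)
    have h4 : (∏ x ∈ Finset.range k, b x) * (b k - a k) ≤ c :=
      (mul_le_of_le_one_left h3 h1).trans (hc k)
    have h5 : a k * (∏ x ∈ Finset.range k, b x - ∏ x ∈ Finset.range k, a x) ≤ k * c :=
      (mul_le_of_le_one_left h2 ((hab k).trans (hb k))).trans ih
    push_cast
    linarith

theorem tendsto_tsum_prod_sub_prod_div {q : ℕ → ℝ} (hq : ∀ k, 0 ≤ q k)
    (hsum : Summable fun k : ℕ => (k : ℝ) * q k) {E : ι → ℕ → Prop} {E' : ℕ → Prop}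
    [∀ i, DecidablePred (E i)] [DecidablePred E']
    (hE : ∀ k, ∀ᶠ i in l, E i k ↔ E' k)
    (hα0 : ∀ i x, 0 ≤ α i x) (hαβ : ∀ i x, α i x ≤ β i x) (hβ1 : ∀ i x, β i x ≤ 1)
    (hr : ∀ i, 0 < r i) (hc : ∀ i x, β i x - α i x ≤ r i)
    (hα : ∀ x, Tendsto (fun i => α i x) l (𝓝 (φ x)))
    (hβ : ∀ x, Tendsto (fun i => β i x) l (𝓝 (φ x)))
    (hd : ∀ x, Tendsto (fun i => (β i x - α i x) / r i) l (𝓝 (ψ x))) :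
    Tendsto (fun i => ∑' k, if E i k then
      q k * ((∏ x ∈ Finset.range k, β i x - ∏ x ∈ Finset.range k, α i x) / r i) else 0) l
      (𝓝 (∑' k, if E' k then
        q k * ∑ x ∈ Finset.range k, ψ x * ∏ y ∈ (Finset.range k).erase x, φ y else 0)) := by
  refine tendsto_tsum_of_dominated_convergence hsum (fun k => ?_) (.of_forall fun i k => ?_)
  · by_cases hk : E' k
    · rw [if_pos hk]
      refine ((tendsto_prod_sub_prod_div hα hβ hd _).const_mul (q k)).congr' ?_
      filter_upwards [hE k] with i hi
      rw [if_pos (hi.2 hk)]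
    · rw [if_neg hk]
      refine tendsto_const_nhds.congr' ?_
      filter_upwards [hE k] with i hi
      rw [if_neg (hi.not.2 hk)]
  · obtain ⟨h0, h1⟩ := prod_sub_prod_mem_Icc (hα0 i) (hαβ i) (hβ1 i) (hc i) k
    split_ifs
    · rw [Real.norm_of_nonneg (mul_nonneg (hq k) (div_nonneg h0 (hr i).le)), mul_comm (k : ℝ)]
      exact mul_le_mul_of_nonneg_left ((div_le_iff₀ (hr i)).2 h1) (hq k)
    · rw [norm_zero]
      exact mul_nonneg k.cast_nonneg (hq k)

end Analysis

/-! ### The mean of the offspring law in real numbers -/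

namespace PMF

variable (p : PMF ℕ)

theorem summable_toReal : Summable fun k => (p k).toReal :=
  ENNReal.summable_toReal p.tsum_coe_ne_top

theorem tsum_toReal : ∑' k, (p k).toReal = 1 := by
  rw [← ENNReal.tsum_toReal_eq p.apply_ne_top, p.tsum_coe, ENNReal.toReal_one]

variable {p}

theorem summable_mul_toReal (h : p.offspringMean ≤ 1) :
    Summable fun k : ℕ => (k : ℝ) * (p k).toReal := by
  have := ENNReal.summable_toReal (f := fun n : ℕ => (n : ℝ≥0∞) * p n)
    (ne_top_of_le_ne_top ENNReal.one_ne_top h)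
  simpa using this

theorem toReal_offspringMean : p.offspringMean.toReal = ∑' k : ℕ, (k : ℝ) * (p k).toReal := by
  rw [offspringMean, ENNReal.tsum_toReal_eq fun n => ENNReal.mul_ne_top (by simp) (p.apply_ne_top n)]
  simp

/-- Without mass at 0 one would have n p_n ≥ p_n for all n, hence mean at least 1. -/
theorem apply_zero_ne_zero (h : p.offspringMean < 1) : p 0 ≠ 0 := by
  intro h0
  refine absurd h (not_lt.2 ?_)
  rw [← p.tsum_coe]
  refine ENNReal.tsum_le_tsum fun n => ?_
  rcases Nat.eq_zero_or_pos n with rfl | hn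
  · simp [h0]
  · exact le_mul_of_one_le_left' (by exact_mod_cast hn)

end PMF

/-! ### Containment probabilities and the weight of a large root degree -/

section GaltonWatson

variable {Ω : Type*} [MeasurableSpace Ω] {p : PMF ℕ} {P : Measure Ω} [IsProbabilityMeasure P]
  {τ : Ω → PlaneTree}

variable (P τ) in
/-- The probability that `τ` contains `W` and has all its out-degrees in `A`. -/
noncomputable def containProb (A : Set ℕ∞) (W : Set (List ℕ)) : ℝ := P.real (τ ⁻¹' containing W A)

theorem containProb_nonneg {P : Measure Ω} (A : Set ℕ∞) (W : Set (List ℕ)) :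
    0 ≤ containProb P τ A W :=
  measureReal_nonneg

theorem containProb_le_one (A : Set ℕ∞) (W : Set (List ℕ)) : containProb P τ A W ≤ 1 :=
  measureReal_le_one

theorem containProb_mono {A B : Set ℕ∞} (h : A ⊆ B) (W : Set (List ℕ)) :
    containProb P τ A W ≤ containProb P τ B W :=
  measureReal_mono (Set.preimage_mono (containing_mono_right W h))

theorem containProb_univ_of_root {W : Set (List ℕ)} (h : ∀ w ∈ W, w = []) :
    containProb P τ Set.univ W = 1 := by
  rw [containProb, containing_eq_of_subset_root h]
  have : containing ∅ Set.univ = Set.univ := by ext; simp [containing]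
  simp [this]

theorem containProb_eq_of_root {P : Measure Ω} {W : Set (List ℕ)} (h : ∀ w ∈ W, w = []) (A : Set ℕ∞) :
    containProb P τ A W = containProb P τ A ∅ := by
  rw [containProb, containing_eq_of_subset_root h, containProb]

/-- The degree event is the same for every W, so the difference is the probability of one fixed
event intersected with containment of W. This makes the normalised difference a conditional
probability. -/
theorem containProb_sub (hτ : Measurable τ) {A B : Set ℕ∞} (h : A ⊆ B) (W : Set (List ℕ)) :
    containProb P τ B W - containProb P τ A W =
      P.real (τ ⁻¹' (containing ∅ B \ containing ∅ A) ∩ τ ⁻¹' wordCylinder W ∅) := by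
  rw [containProb, containProb, ← measureReal_sdiff
    (Set.preimage_mono (containing_mono_right W h)) (hτ (measurableSet_containing _ _))]
  congr 1
  ext ω
  simp only [Set.mem_sdiff, Set.mem_preimage, Set.mem_inter_iff, containing, wordCylinder,
    Set.mem_ofPred_eq]
  simp
  tauto

theorem containProb_sub_le (hτ : Measurable τ) {A B : Set ℕ∞} (h : A ⊆ B) (W : Set (List ℕ)) :
    containProb P τ B W - containProb P τ A W ≤
      containProb P τ B ∅ - containProb P τ A ∅ := by
  rw [containProb_sub hτ h, containProb_sub hτ h]
  refine measureReal_mono (Set.inter_subset_inter_right _ (Set.preimage_mono fun t _ => ?_))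
  exact ⟨fun _ h => h.elim, fun _ h => h.elim⟩

open Classical in
theorem IsGaltonWatsonTree.containProb_eq (hτ : IsGaltonWatsonTree p P τ) (A : Set ℕ∞)
    (W : Set (List ℕ)) :
    containProb P τ A W = ∑' k : ℕ, if (k : ℕ∞) ∈ A ∧ Fits W k then
      (p k).toReal * ∏ i ∈ Finset.range k, containProb P τ A (tails W i) else 0 := by
  rw [containProb, Measure.real, hτ.measure_containing, ENNReal.tsum_toReal_eq]
  · refine tsum_congr fun k => ?_
    split_ifs
    · rw [ENNReal.toReal_mul, ENNReal.toReal_prod]; rfl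
    · rfl
  · intro k
    split_ifs
    · exact ENNReal.mul_ne_top (p.apply_ne_top k)
        (ENNReal.prod_ne_top fun i _ => measure_ne_top _ _)
    · exact ENNReal.zero_ne_top

theorem summable_containProb_terms (E : ℕ → Prop) [DecidablePred E] (A : Set ℕ∞) (W : ℕ → Set (List ℕ)) :
    Summable fun k : ℕ => if E k then
      (p k).toReal * ∏ i ∈ Finset.range k, containProb P τ A (W i) else 0 := by
  refine Summable.of_nonneg_of_le (fun k => ?_) (fun k => ?_) p.summable_toReal
  · split_ifs
    · exact mul_nonneg ENNReal.toReal_nonneg (Finset.prod_nonneg fun i _ => containProb_nonneg _ _)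
    · exact le_rfl
  · split_ifs
    · exact mul_le_of_le_one_right ENNReal.toReal_nonneg
        (Finset.prod_le_one (fun i _ => containProb_nonneg _ _) fun i _ => containProb_le_one _ _)
    · exact ENNReal.toReal_nonneg

variable {ι : Type*} {l : Filter ι} {A B : ι → Set ℕ∞}

/-- Write F for the probability at hand. Bernoulli's inequality 1 ≤ F^k + k(1 - F), summed against p
with F = ∑ p_k F^k over A, gives (1 - F)(1 - μ) ≤ p(Aᶜ). The right side tends to 0, and μ < 1. -/
theorem tendsto_containProb_empty (hτ : IsGaltonWatsonTree p P τ) (hsub : p.offspringMean < 1)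
    (hA : ∀ k : ℕ, ∀ᶠ i in l, (k : ℕ∞) ∈ A i) :
    Tendsto (fun i => containProb P τ (A i) ∅) l (𝓝 1) := by
  classical
  set μ := p.offspringMean.toReal with hμ
  have hμ1 : μ < 1 := by
    rw [hμ, ← ENNReal.toReal_one]
    exact (ENNReal.toReal_lt_toReal (ne_top_of_lt hsub) ENNReal.one_ne_top).2 hsub
  have htail : Tendsto (fun i => ∑' k : ℕ, if (k : ℕ∞) ∈ A i then 0 else (p k).toReal) l (𝓝 0) := by
    have := tendsto_tsum_of_dominated_convergence (𝓕 := l) (g := fun _ : ℕ => (0 : ℝ))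
      (f := fun i (k : ℕ) => if (k : ℕ∞) ∈ A i then 0 else (p k).toReal) p.summable_toReal
      (fun k => tendsto_const_nhds.congr' ?_) (.of_forall fun i k => ?_)
    · simpa using this
    · filter_upwards [hA k] with i hi
      rw [if_pos hi]
    · split_ifs <;> simp
  have hle : ∀ i, (1 - containProb P τ (A i) ∅) * (1 - μ) ≤
      ∑' k : ℕ, if (k : ℕ∞) ∈ A i then 0 else (p k).toReal := by
    intro i
    set F := containProb P τ (A i) ∅ with hF
    have hF0 : 0 ≤ F := containProb_nonneg _ _
    have hF1 : F ≤ 1 := containProb_le_one _ _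
    have hrec := hτ.containProb_eq (A i) ∅
    simp only [fits_empty, and_true, tails_empty, Finset.prod_const, Finset.card_range] at hrec
    rw [← hF] at hrec
    have hs1 : Summable fun k : ℕ => if (k : ℕ∞) ∈ A i then (p k).toReal * F ^ k else 0 := by
      simpa using summable_containProb_terms (p := p) (P := P) (τ := τ)
        (fun k => (k : ℕ∞) ∈ A i) (A i) fun _ => ∅
    have hs2 : Summable fun k : ℕ => if (k : ℕ∞) ∈ A i then 0 else (p k).toReal :=
      Summable.of_nonneg_of_le (fun k => by split_ifs <;> simp) (fun k => by split_ifs <;> simp)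
        p.summable_toReal
    have hs3 : Summable fun k : ℕ => (k : ℝ) * (p k).toReal * (1 - F) :=
      (p.summable_mul_toReal hsub.le).mul_right _
    have hkey : (1 : ℝ) ≤ F + (∑' k : ℕ, if (k : ℕ∞) ∈ A i then 0 else (p k).toReal) +
        μ * (1 - F) := by
      have hsums := calc
        ∑' k, (p k).toReal ≤ _ := ?_
        _ = _ := ((hs1.add hs2).tsum_add hs3).trans
          (congrArg₂ (· + ·) (hs1.tsum_add hs2) (tsum_mul_right))
      · rwa [p.tsum_toReal, ← hrec, ← PMF.toReal_offspringMean] at hsums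
      refine p.summable_toReal.tsum_le_tsum (fun k => ?_) ((hs1.add hs2).add hs3)
      have hp0 : 0 ≤ (p k).toReal := ENNReal.toReal_nonneg
      split_ifs
      · have := one_add_mul_sub_le_pow (a := F) (by linarith) k
        nlinarith
      · have : 0 ≤ (k : ℝ) * (p k).toReal * (1 - F) := by
          have := sub_nonneg.2 hF1
          positivity
        linarith
    linarith
  have hlim : Tendsto (fun i => 1 - containProb P τ (A i) ∅) l (𝓝 0) := by
    refine squeeze_zero (fun i => sub_nonneg.2 (containProb_le_one _ _))
      (fun i => (le_div_iff₀ (sub_pos.2 hμ1)).2 (hle i)) ?_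
    simpa using htail.div_const (1 - μ)
  simpa using hlim.const_sub 1

theorem tendsto_containProb (hτ : IsGaltonWatsonTree p P τ) (hsub : p.offspringMean < 1)
    (hA : ∀ k : ℕ, ∀ᶠ i in l, (k : ℕ∞) ∈ A i) (W : Set (List ℕ)) :
    Tendsto (fun i => containProb P τ (A i) W) l (𝓝 (containProb P τ Set.univ W)) := by
  have h := tendsto_containProb_empty hτ hsub hA
  have hlim : Tendsto (fun i => containProb P τ Set.univ W - containProb P τ (A i) W) l (𝓝 0) := by
    refine squeeze_zero (fun i => sub_nonneg.2 (containProb_mono (Set.subset_univ _) W))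
      (fun i => containProb_sub_le hτ.measurable (Set.subset_univ _) W) ?_
    rw [containProb_univ_of_root fun w h => h.elim]
    simpa using h.const_sub 1
  simpa using hlim.const_sub (containProb P τ Set.univ W)

open Classical in
/-- The probability that the out-degree of the root belongs to `B \ A`, `τ` contains `W`, and all
the out-degrees belong to `B`. -/
noncomputable def jumpProb (p : PMF ℕ) (P : Measure Ω) (τ : Ω → PlaneTree) (A B : Set ℕ∞)
    (W : Set (List ℕ)) : ℝ :=
  ∑' k : ℕ, if (k : ℕ∞) ∈ B \ A ∧ Fits W k then
    (p k).toReal * ∏ i ∈ Finset.range k, containProb P τ B (tails W i) else 0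

open Classical in
-- Root degrees in B \ A occur only in the recursion for B; those in A occur in both and leave a
-- difference of products.
theorem IsGaltonWatsonTree.containProb_sub_div (hτ : IsGaltonWatsonTree p P τ) {A B : Set ℕ∞}
    (hAB : A ⊆ B) (W : Set (List ℕ)) (r : ℝ) :
    (containProb P τ B W - containProb P τ A W) / r =
      jumpProb p P τ A B W / r + ∑' k : ℕ, if (k : ℕ∞) ∈ A ∧ Fits W k then
        (p k).toReal * ((∏ i ∈ Finset.range k, containProb P τ B (tails W i) -
          ∏ i ∈ Finset.range k, containProb P τ A (tails W i)) / r) else 0 := by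
  have hsA := summable_containProb_terms (p := p) (P := P) (τ := τ)
    (fun k => (k : ℕ∞) ∈ A ∧ Fits W k) A (tails W)
  have hsB := summable_containProb_terms (p := p) (P := P) (τ := τ)
    (fun k => (k : ℕ∞) ∈ A ∧ Fits W k) B (tails W)
  have hsBA := summable_containProb_terms (p := p) (P := P) (τ := τ)
    (fun k => (k : ℕ∞) ∈ B \ A ∧ Fits W k) B (tails W)
  have hB : containProb P τ B W = jumpProb p P τ A B W + ∑' k : ℕ,
      if (k : ℕ∞) ∈ A ∧ Fits W k then
        (p k).toReal * ∏ i ∈ Finset.range k, containProb P τ B (tails W i) else 0 := by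
    rw [hτ.containProb_eq, jumpProb, ← hsBA.tsum_add hsB]
    refine tsum_congr fun k => ?_
    by_cases h1 : (k : ℕ∞) ∈ A
    · simp [h1, hAB h1]
    · simp [h1]
  rw [hB, hτ.containProb_eq A W, add_sub_assoc, ← hsB.tsum_sub hsA, add_div, ← tsum_div_const]
  congr 1
  refine tsum_congr fun k => ?_
  split_ifs
  · ring
  · simp

/-- For W = ∅ the normalised difference is identically 1, and its part with root degree in A tends
to ∑ k p_k. The jump is what remains. -/
theorem tendsto_jumpProb_empty (hτ : IsGaltonWatsonTree p P τ) (hsub : p.offspringMean < 1)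
    (hA : ∀ k : ℕ, ∀ᶠ i in l, (k : ℕ∞) ∈ A i) (hAB : ∀ i, A i ⊆ B i)
    (hr : ∀ i, 0 < containProb P τ (B i) ∅ - containProb P τ (A i) ∅) :
    Tendsto (fun i => jumpProb p P τ (A i) (B i) ∅ /
      (containProb P τ (B i) ∅ - containProb P τ (A i) ∅)) l
      (𝓝 (1 - p.offspringMean.toReal)) := by
  classical
  have hlimA := tendsto_containProb_empty hτ hsub hA
  have hlimB := tendsto_containProb_empty hτ hsub fun k => (hA k).mono fun i hi => hAB i hi
  have h := tendsto_tsum_prod_sub_prod_div (l := l) (q := fun k => (p k).toReal)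
    (E := fun i k => (k : ℕ∞) ∈ A i ∧ Fits ∅ k) (E' := fun _ => True)
    (α := fun i x => containProb P τ (A i) (tails ∅ x))
    (β := fun i x => containProb P τ (B i) (tails ∅ x))
    (r := fun i => containProb P τ (B i) ∅ - containProb P τ (A i) ∅)
    (φ := fun _ => 1) (ψ := fun _ => 1) (fun k => ENNReal.toReal_nonneg)
    (p.summable_mul_toReal hsub.le) (fun k => (hA k).mono fun i hi => by simp [hi, fits_empty])
    (fun _ _ => containProb_nonneg _ _) (fun i _ => containProb_mono (hAB i) _)
    (fun _ _ => containProb_le_one _ _) hr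
    (fun i _ => containProb_sub_le hτ.measurable (hAB i) _) (fun _ => hlimA) (fun _ => hlimB)
    (fun _ => tendsto_const_nhds.congr fun i => (div_self (hr i).ne').symm)
  have hμ : ∑' k : ℕ, (if True then (p k).toReal *
      ∑ x ∈ Finset.range k, (1 : ℝ) * ∏ y ∈ (Finset.range k).erase x, (1 : ℝ) else 0) =
      p.offspringMean.toReal := by
    rw [PMF.toReal_offspringMean]
    exact tsum_congr fun k => by simp [mul_comm]
  rw [hμ] at h
  refine (h.const_sub 1).congr fun i => ?_
  have := hτ.containProb_sub_div (hAB i) ∅ (containProb P τ (B i) ∅ - containProb P τ (A i) ∅)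
  rw [div_self (hr i).ne'] at this
  linarith

/-- Eventually every degree k outside A is at least j, so W fits and constrains only the first j
children. The jump for W is then exactly the jump for ∅ times a ratio independent of k, so powers
with growing exponent never need estimating. -/
theorem tendsto_jumpProb (hτ : IsGaltonWatsonTree p P τ) (hsub : p.offspringMean < 1)
    (hA : ∀ k : ℕ, ∀ᶠ i in l, (k : ℕ∞) ∈ A i) (hAB : ∀ i, A i ⊆ B i)
    (hr : ∀ i, 0 < containProb P τ (B i) ∅ - containProb P τ (A i) ∅)
    {W : Set (List ℕ)} {j : ℕ} (hj : ∀ k : ℕ, Fits W k ↔ j ≤ k) :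
    Tendsto (fun i => jumpProb p P τ (A i) (B i) W /
      (containProb P τ (B i) ∅ - containProb P τ (A i) ∅)) l
      (𝓝 ((1 - p.offspringMean.toReal) *
        ∏ i ∈ Finset.range j, containProb P τ Set.univ (tails W i))) := by
  classical
  have hB : ∀ k : ℕ, ∀ᶠ i in l, (k : ℕ∞) ∈ B i := fun k => (hA k).mono fun i hi => hAB i hi
  have hlimB := tendsto_containProb_empty hτ hsub hB
  have hfac : Tendsto (fun i => (∏ x ∈ Finset.range j, containProb P τ (B i) (tails W x)) /
      containProb P τ (B i) ∅ ^ j) l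
      (𝓝 ((∏ x ∈ Finset.range j, containProb P τ Set.univ (tails W x)) / 1 ^ j)) :=
    (tendsto_finsetProd _ fun x _ => tendsto_containProb hτ hsub hB _).div (hlimB.pow j) (by simp)
  rw [one_pow, div_one] at hfac
  refine ((tendsto_jumpProb_empty hτ hsub hA hAB hr).mul hfac).congr' ?_
  have hev : ∀ᶠ i in l, ∀ k ∈ Finset.range j, (k : ℕ∞) ∈ A i :=
    (Finset.range j).eventually_all.2 fun k _ => hA k
  filter_upwards [hev, hlimB.eventually (lt_mem_nhds zero_lt_one)] with i hi hpos
  rw [div_mul_eq_mul_div]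
  congr 1
  rw [jumpProb, jumpProb, ← tsum_mul_right]
  refine tsum_congr fun k => ?_
  by_cases hk : (k : ℕ∞) ∈ B i \ A i
  · have hjk : j ≤ k := by
      by_contra hlt
      exact hk.2 (hi k (Finset.mem_range.2 (not_le.1 hlt)))
    have hprod : ∏ x ∈ Finset.range k, containProb P τ (B i) (tails W x) =
        (∏ x ∈ Finset.range j, containProb P τ (B i) (tails W x)) *
          containProb P τ (B i) ∅ ^ (k - j) := by
      rw [← Finset.prod_range_mul_prod_Ico _ hjk]
      congr 1
      rw [Finset.prod_congr rfl fun x hx => by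
        rw [((hj j).2 le_rfl).tails_eq_empty (Finset.mem_Ico.1 hx).1]]
      simp
    rw [if_pos ⟨hk, fits_empty _⟩, if_pos ⟨hk, (hj k).2 hjk⟩, hprod]
    simp only [tails_empty, Finset.prod_const, Finset.card_range]
    rw [← pow_sub_mul_pow _ hjk]
    field_simp
  · rw [if_neg fun h => hk h.1, if_neg fun h => hk h.1, zero_mul]

end GaltonWatson

/-! ### Identification of the limit and weak convergence -/

section Convergence

variable {Ω : Type*} [MeasurableSpace Ω] {p : PMF ℕ} {P : Measure Ω} [IsProbabilityMeasure P]
  {τ : Ω → PlaneTree}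

theorem length_le_of_mem_tails {W : Set (List ℕ)} {h : ℕ} (hW : ∀ w ∈ W, w.length ≤ h + 1) (i : ℕ) :
    ∀ w ∈ tails W i, w.length ≤ h := fun w hw => by simpa using hW _ hw

theorem eq_nil_of_length_le_zero {W : Set (List ℕ)} (hW : ∀ w ∈ W, w.length ≤ 0) :
    ∀ w ∈ W, w = [] := fun w hw => List.eq_nil_of_length_eq_zero (Nat.le_zero.1 (hW w hw))

/-- The tree of normal nodes is distributed as a Galton–Watson tree. -/
theorem IsGaltonWatsonTree.measure_containing_univ (hτ : IsGaltonWatsonTree p P τ)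
    (hp : p.offspringMean ≤ 1) (h : ℕ) {W : Set (List ℕ)} (hW : ∀ w ∈ W, w.length ≤ h) :
    P (τ ⁻¹' containing W Set.univ) =
      Condensation.markLaw p hp (Condensation.normalEvent W) := by
  classical
  induction h generalizing W with
  | zero =>
    have hW' := eq_nil_of_length_le_zero hW
    have : containing ∅ Set.univ = Set.univ := by ext; simp [containing]
    rw [containing_eq_of_subset_root hW', this, Condensation.normalEvent_eq_univ hW']
    simp
  | succ h ih =>
    rw [hτ.measure_containing, Condensation.markLaw_normalEvent]
    refine tsum_congr fun k => ?_
    simp only [Set.mem_univ, true_and]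
    split_ifs
    · congr 1
      exact Finset.prod_congr rfl fun i _ => ih (length_le_of_mem_tails hW i)
    · rfl

theorem IsGaltonWatsonTree.containProb_univ (hτ : IsGaltonWatsonTree p P τ)
    (hp : p.offspringMean ≤ 1) {W : Set (List ℕ)} (hW : W.Finite) :
    containProb P τ Set.univ W =
      (Condensation.markLaw p hp).real (Condensation.normalEvent W) := by
  obtain ⟨h, hh⟩ := (hW.image List.length).bddAbove
  rw [containProb, Measure.real, hτ.measure_containing_univ hp h fun w hw => hh ⟨w, hw, rfl⟩]
  rfl

open Classical in
theorem Condensation.markLaw_real_treeEvent (hp : p.offspringMean ≤ 1) {W : Set (List ℕ)} {j : ℕ}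
    (hj : Fits W j) :
    (markLaw p hp).real (treeEvent W) = (1 - p.offspringMean.toReal) *
        ∏ i ∈ Finset.range j, (markLaw p hp).real (normalEvent (tails W i)) +
      ∑' k : ℕ, if Fits W k then (p k).toReal *
        ∑ l ∈ Finset.range k, (markLaw p hp).real (treeEvent (tails W l)) *
        ∏ i ∈ (Finset.range k).erase l, (markLaw p hp).real (normalEvent (tails W i)) else 0 := by
  have hfin : (markLaw p hp) (treeEvent W) ≠ ⊤ := measure_ne_top _ _
  rw [markLaw_treeEvent hj] at hfin
  rw [Measure.real, markLaw_treeEvent hj,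
    ENNReal.toReal_add (ne_top_of_le_ne_top hfin le_self_add)
      (ne_top_of_le_ne_top hfin le_add_self), ENNReal.toReal_mul,
    ENNReal.toReal_sub_of_le hp ENNReal.one_ne_top, ENNReal.toReal_one, ENNReal.toReal_prod,
    ENNReal.tsum_toReal_eq fun k => ne_top_of_le_ne_top (ne_top_of_le_ne_top hfin le_add_self)
      (ENNReal.le_tsum k)]
  congr 1
  refine tsum_congr fun k => ?_
  split_ifs
  · rw [ENNReal.toReal_mul, ENNReal.toReal_sum fun l _ => ENNReal.mul_ne_top (measure_ne_top _ _)
      (ENNReal.prod_ne_top fun i _ => measure_ne_top _ _)]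
    simp_rw [ENNReal.toReal_mul, ENNReal.toReal_prod]
    rfl
  · rfl

variable {ι : Type*} {l : Filter ι} {A B : ι → Set ℕ∞}

/-- Induction on the length bound: the limits of the jump and of the product differences are the two
terms of the recursion for τ*(p), the inductive hypothesis supplying the derivative at the special
child. -/
theorem tendsto_containProb_sub_div (hτ : IsGaltonWatsonTree p P τ) (hsub : p.offspringMean < 1)
    (hA : ∀ k : ℕ, ∀ᶠ i in l, (k : ℕ∞) ∈ A i) (hAB : ∀ i, A i ⊆ B i)
    (hr : ∀ i, 0 < containProb P τ (B i) ∅ - containProb P τ (A i) ∅) (h : ℕ)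
    {W : Set (List ℕ)} (hfin : W.Finite) (hW : ∀ w ∈ W, w.length ≤ h) :
    Tendsto (fun i => (containProb P τ (B i) W - containProb P τ (A i) W) /
      (containProb P τ (B i) ∅ - containProb P τ (A i) ∅)) l
      (𝓝 ((Condensation.markLaw p hsub.le).real (Condensation.treeEvent W))) := by
  classical
  induction h generalizing W with
  | zero =>
    have hW' := eq_nil_of_length_le_zero hW
    rw [Condensation.treeEvent_eq_univ hW', probReal_univ]
    refine tendsto_const_nhds.congr fun i => ?_
    rw [containProb_eq_of_root hW', containProb_eq_of_root hW', div_self (hr i).ne']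
  | succ h ih =>
    obtain ⟨j, hj⟩ := exists_forall_fits_iff hfin
    rw [Condensation.markLaw_real_treeEvent hsub.le ((hj j).2 le_rfl)]
    simp_rw [fun i => hτ.containProb_sub_div (hAB i) W
      (containProb P τ (B i) ∅ - containProb P τ (A i) ∅)]
    simp_rw [← fun i => hτ.containProb_univ hsub.le (finite_tails hfin i)]
    refine (tendsto_jumpProb hτ hsub hA hAB hr hj).add ?_
    exact tendsto_tsum_prod_sub_prod_div (fun k => ENNReal.toReal_nonneg)
      (p.summable_mul_toReal hsub.le)
      (fun k => (hA k).mono fun i hi => by simp [hi])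
      (fun _ _ => containProb_nonneg _ _) (fun i _ => containProb_mono (hAB i) _)
      (fun _ _ => containProb_le_one _ _) hr
      (fun i _ => containProb_sub_le hτ.measurable (hAB i) _)
      (fun x => tendsto_containProb hτ hsub hA _)
      (fun x => tendsto_containProb hτ hsub (fun k => (hA k).mono fun i hi => hAB i hi) _)
      fun x => ih (finite_tails hfin x) (length_le_of_mem_tails hW x)

/-- Weak convergence of random trees follows from the convergence of the probabilities of
containing finite sets of words. -/
theorem PlaneTree.tendsto_probabilityMeasure [l.IsCountablyGenerated]
    {μ : ι → ProbabilityMeasure PlaneTree} {ν : ProbabilityMeasure PlaneTree}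
    (h : ∀ W : Set (List ℕ), W.Finite → Tendsto (fun i => (μ i : Measure PlaneTree).real
      (wordCylinder W ∅)) l (𝓝 ((ν : Measure PlaneTree).real (wordCylinder W ∅)))) :
    Tendsto μ l (𝓝 ν) := by
  have hmeas : ∀ {W V : Set (List ℕ)}, W.Finite → V.Finite → MeasurableSet (wordCylinder W V) :=
    fun hW hV => (isClopen_wordCylinder hW hV).isOpen.measurableSet
  -- Forbidden words are added one by one: avoiding v is the complement of containing v, so W must
  -- stay arbitrary in the induction.
  have key : ∀ V : Set (List ℕ), V.Finite → ∀ W : Set (List ℕ), W.Finite →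
      Tendsto (fun i => (μ i : Measure PlaneTree).real (wordCylinder W V)) l
        (𝓝 ((ν : Measure PlaneTree).real (wordCylinder W V))) := by
    intro V hV
    induction V, hV using Set.Finite.induction_on with
    | empty => exact h
    | @insert v V _ hV ih =>
      intro W hW
      have hdiff : wordCylinder W (insert v V) =
          wordCylinder W V \ wordCylinder (insert v W) V := by
        ext t
        simp only [wordCylinder, Set.mem_ofPred_eq, Set.mem_sdiff, Set.forall_mem_insert]
        tauto
      have hsub : wordCylinder (insert v W) V ⊆ wordCylinder W V :=
        fun t ht => ⟨fun w hw => ht.1 w (Set.mem_insert_of_mem v hw), ht.2⟩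
      have hreal : ∀ ρ : ProbabilityMeasure PlaneTree,
          (ρ : Measure PlaneTree).real (wordCylinder W (insert v V)) =
            (ρ : Measure PlaneTree).real (wordCylinder W V) -
              (ρ : Measure PlaneTree).real (wordCylinder (insert v W) V) := fun ρ => by
        rw [hdiff, measureReal_sdiff hsub (hmeas (hW.insert v) hV)]
      simp_rw [hreal]
      exact (ih W hW).sub (ih _ (hW.insert v))
  refine IsPiSystem.tendsto_probabilityMeasure_of_tendsto_of_mem
    (S := {S | ∃ W V : Set (List ℕ), W.Finite ∧ V.Finite ∧ S = wordCylinder W V}) ?_ ?_ ?_ ?_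
  · rintro _ ⟨W, V, hW, hV, rfl⟩ _ ⟨W', V', hW', hV', rfl⟩ _
    refine ⟨W ∪ W', V ∪ V', hW.union hW', hV.union hV', ?_⟩
    ext t
    simp only [wordCylinder, Set.mem_ofPred_eq, Set.mem_inter_iff, Set.mem_union, or_imp,
      forall_and]
    tauto
  · rintro _ ⟨W, V, hW, hV, rfl⟩
    exact hmeas hW hV
  · intro U hU t ht
    obtain ⟨W, V, hW, hV, h1, h2⟩ := exists_wordCylinder_subset hU ht
    exact ⟨_, ⟨W, V, hW, hV, rfl⟩, (isClopen_wordCylinder hW hV).isOpen.mem_nhds h1, h2⟩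
  · rintro _ ⟨W, V, hW, hV, rfl⟩
    rw [← NNReal.tendsto_coe]
    exact key V hV W hW

/-- A root with k children and all degrees in B has probability p_k F_B(∅)^k and violates A. This is
positive, as the one-vertex tree alone gives F_B(∅) ≥ p_0 > 0. -/
theorem IsGaltonWatsonTree.containProb_sub_pos (hτ : IsGaltonWatsonTree p P τ)
    (hsub : p.offspringMean < 1) {A B : Set ℕ∞} (hAB : A ⊆ B) (h0 : 0 ∈ B) {k : ℕ} (hk : p k ≠ 0)
    (hkB : (k : ℕ∞) ∈ B) (hkA : (k : ℕ∞) ∉ A) :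
    0 < containProb P τ B ∅ - containProb P τ A ∅ := by
  classical
  have hpos : P (τ ⁻¹' containing ∅ B) ≠ 0 := by
    have := hτ.measure_inter ∅ B 0
    rw [if_pos ⟨by simpa using h0, fits_empty _⟩, Finset.prod_range_zero, mul_one] at this
    intro h
    exact PMF.apply_zero_ne_zero hsub
      (this.symm.trans (measure_mono_null Set.inter_subset_right h))
  have hjump := hτ.measure_inter ∅ B k
  rw [if_pos ⟨hkB, fits_empty _⟩] at hjump
  simp only [tails_empty, Finset.prod_const, Finset.card_range] at hjump
  have hne : P (τ ⁻¹' containing ∅ B \ τ ⁻¹' containing ∅ A) ≠ 0 := by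
    intro h
    refine mul_ne_zero hk (pow_ne_zero k hpos) (hjump.symm.trans (measure_mono_null ?_ h))
    rintro ω ⟨hω, hωB⟩
    refine ⟨hωB, fun hωA => hkA ?_⟩
    have hω' : (τ ω).outDegree [] = k := hω
    exact hω' ▸ hωA.2 [] (nil_mem _)
  rw [containProb, containProb, ← measureReal_sdiff
    (Set.preimage_mono (containing_mono_right ∅ hAB)) (hτ.measurable (measurableSet_containing _ _))]
  exact ENNReal.toReal_pos hne (measure_ne_top _ _)

/-- Convergence to the condensation tree under conditioning on a vanishing event
`{all out-degrees in B, but not all in A}`. -/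
theorem IsGaltonWatsonTree.tendstoInDistribution_cond (hτ : IsGaltonWatsonTree p P τ)
    (hsub : p.offspringMean < 1) [l.IsCountablyGenerated]
    (hA : ∀ k : ℕ, ∀ᶠ i in l, (k : ℕ∞) ∈ A i) (hAB : ∀ i, A i ⊆ B i)
    (hr : ∀ i, 0 < containProb P τ (B i) ∅ - containProb P τ (A i) ∅) {D : ι → Set Ω}
    (hD : ∀ i, D i = τ ⁻¹' (containing ∅ (B i) \ containing ∅ (A i))) :
    ∃ _ : ∀ i, IsProbabilityMeasure P[|D i],
      TendstoInDistribution (fun _ : ι => τ) l Condensation.tree (fun i => P[|D i])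
        (Condensation.markLaw p hsub.le) := by
  have hDm : ∀ i, MeasurableSet (D i) := fun i => by
    rw [hD i]
    exact hτ.measurable ((measurableSet_containing _ _).diff (measurableSet_containing _ _))
  have hsubr : ∀ i W, containProb P τ (B i) W - containProb P τ (A i) W =
      P.real (D i ∩ τ ⁻¹' wordCylinder W ∅) := fun i W => by
    rw [containProb_sub hτ.measurable (hAB i), hD i]
  have hemp : wordCylinder ∅ ∅ = Set.univ :=
    Set.eq_univ_of_forall fun t => ⟨fun _ h => h.elim, fun _ h => h.elim⟩
  have hDr : ∀ i, containProb P τ (B i) ∅ - containProb P τ (A i) ∅ = P.real (D i) := fun i => by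
    rw [hsubr, hemp, Set.preimage_univ, Set.inter_univ]
  have hprob : ∀ i, IsProbabilityMeasure P[|D i] := fun i => by
    refine cond_isProbabilityMeasure fun h => (hr i).ne' ?_
    rw [hDr i, Measure.real, h, ENNReal.toReal_zero]
  refine ⟨hprob, ⟨fun i => hτ.measurable.aemeasurable,
    Condensation.measurable_tree.aemeasurable, tendsto_probabilityMeasure fun W hW => ?_⟩⟩
  have hcyl : MeasurableSet (wordCylinder W ∅) :=
    (isClopen_wordCylinder hW Set.finite_empty).isOpen.measurableSet
  obtain ⟨h, hh⟩ := (hW.image List.length).bddAbove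
  have hlim := tendsto_containProb_sub_div hτ hsub hA hAB hr h hW fun w hw => hh ⟨w, hw, rfl⟩
  have htree : Condensation.treeEvent W = Condensation.tree ⁻¹' wordCylinder W ∅ := by
    ext m; simp [Condensation.treeEvent, wordCylinder]
  rw [htree] at hlim
  simp only [ProbabilityMeasure.coe_mk]
  rw [map_measureReal_apply Condensation.measurable_tree hcyl]
  refine hlim.congr fun i => ?_
  rw [map_measureReal_apply hτ.measurable hcyl, hsubr, hDr, div_eq_inv_mul, measureReal_def P[|D i],
    cond_apply (hDm i), ENNReal.toReal_mul, ENNReal.toReal_inv]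
  rfl

end Convergence

/-! ### The two conditionings -/

/-- Local convergence in distribution, to the condensation tree `τ*(p)`, of a sub-critical
Galton–Watson tree with unbounded offspring distribution conditioned on `M(τ) = n` (along
`{n | p n ≠ 0}`) or on `M(τ) > n`; both conditionings are on events of positive probability, and
the condensation tree a.s. has exactly one node of infinite out-degree. -/
theorem mainTheorem2 (p : PMF ℕ) (hsub : p.offspringMean < 1) (hunb : ¬ BddAbove p.support)
    {Ω : Type*} [MeasurableSpace Ω] (P : Measure Ω) [IsProbabilityMeasure P]
    (τ : Ω → PlaneTree) (hτ : IsGaltonWatsonTree p P τ) :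
    (∃ _ : ∀ n : p.support,
        IsProbabilityMeasure P[|{ω | (τ ω).maxOutDegree = ((n : ℕ) : ℕ∞)}],
      TendstoInDistribution (fun _ : p.support => τ) atTop Condensation.tree
        (fun n : p.support => P[|{ω | (τ ω).maxOutDegree = ((n : ℕ) : ℕ∞)}])
        (Condensation.markLaw p hsub.le)) ∧
    (∃ _ : ∀ n : ℕ, IsProbabilityMeasure P[|{ω | (n : ℕ∞) < (τ ω).maxOutDegree}],
      TendstoInDistribution (fun _ : ℕ => τ) atTop Condensation.tree
        (fun n : ℕ => P[|{ω | (n : ℕ∞) < (τ ω).maxOutDegree}])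
        (Condensation.markLaw p hsub.le)) ∧
    (∀ᵐ m ∂(Condensation.markLaw p hsub.le),
      ∃! u : List ℕ, u ∈ Condensation.tree m ∧ (Condensation.tree m).outDegree u = ⊤) := by
  have hlarge : ∀ n : ℕ, ∃ k : p.support, n < k := fun n => by
    obtain ⟨k, hk, hnk⟩ := not_bddAbove_iff.1 hunb n
    exact ⟨⟨k, hk⟩, hnk⟩
  refine ⟨?_, ?_, Condensation.ae_existsUnique_outDegree_eq_top hsub⟩
  · refine hτ.tendstoInDistribution_cond hsub (A := fun n : p.support => Set.Iio ((n : ℕ) : ℕ∞))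
      (B := fun n : p.support => Set.Iic ((n : ℕ) : ℕ∞)) (fun k => ?_)
      (fun n => Set.Iio_subset_Iic_self) (fun n => ?_) fun n => ?_
    -- The filter `atTop` lives on the support of p; unboundedness provides an index beyond k, from
    -- which k stays allowed.
    · obtain ⟨n, hn⟩ := hlarge k
      filter_upwards [eventually_ge_atTop n] with m hm
      have hkm : k < (m : ℕ) := hn.trans_le hm
      exact Set.mem_Iio.2 (by exact_mod_cast hkm)
    · exact hτ.containProb_sub_pos hsub Set.Iio_subset_Iic_self (by simp)
        ((p.mem_support_iff n).1 n.2) (by simp) (by simp)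
    · ext ω
      exact maxOutDegree_eq_iff (τ ω) n
  · refine hτ.tendstoInDistribution_cond hsub (A := fun n : ℕ => Set.Iic (n : ℕ∞))
      (B := fun _ => Set.univ) (fun k => ?_) (fun n => Set.subset_univ _) (fun n => ?_) fun n => ?_
    · filter_upwards [eventually_ge_atTop k] with n hn
      exact Set.mem_Iic.2 (by exact_mod_cast hn)
    -- A degree k > n in the support witnesses that M(τ) > n has positive probability.
    · obtain ⟨k, hk⟩ := hlarge n
      exact hτ.containProb_sub_pos hsub (Set.subset_univ _) trivial
        ((p.mem_support_iff k).1 k.2) trivial (by simpa using hk)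
    · ext ω
      exact lt_maxOutDegree_iff (τ ω) n
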